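/- Let $\mathbb F$ be $\mathbb R$ or $\mathbb C$, and consider the plant $$x_{k+1}=Ax_k+\nu_kBu_k+Gw_k,\qquad y_k=\gamma_kLx_k+\gamma_kHw_k,\qquad k=0,1,2,\dots,$$ with constant matrices $A,B,G,L,H$ over $\mathbb F$ of compatible sizes. Here $(w_k)$ is white noise: $\mathbb E[w_k]=0$, $\mathbb E[w_kw_k^*]=\mathbb I$, $\mathbb E[w_kw_l^*]=0$ for $k\ne l$. The binary variables $\nu_k,\gamma_k\in\{0,1\}$ (1: packet delivered) describe packet losses on the actuation and the sensing link. They are governed by time-homogeneous ergodic Markov chains $\theta_k\in\{1,\dots,N\}$ and $\eta_k\in\{1,\dots,I\}$ with transition probability matrices $P=[p_{ij}]$ and $Q=[q_{mn}]$, where ergodic means that the law of the mode converges to a steady state distribution that does not depend on the initial mode. Given $\theta_k=i$, $\nu_k$ equals $1$ with probability $\hat\nu_i$, independently of the rest of the actuation channel; given $\eta_k=n$, $\gamma_k$ equals $1$ with probability $\hat\gamma_n$, independently of the rest of the sensing channel. The initial state (square integrable), the actuation channel $(\nu_k,\theta_k)_k$ together with $\theta_{-1}$, the sensing channel $(\gamma_k,\eta_k)_k$,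 and the noise sequence are independent. A system $\xi_{k+1}=\Gamma_k\xi_k+\Sigma_kw_k$, whose matrices $\Gamma_k,\Sigma_k$ are functions of the mode $(\nu_k,\theta_k,\theta_{k-1},\gamma_k,\eta_k)$, is called *mean square stable* if there are $\mu_e$ and $Q_e$ such that $\mathbb E[\xi_k]\to\mu_e$ and $\mathbb E[\xi_k\xi_k^*]\to Q_e$ as $k\to\infty$ for every initial condition, that is, for every law of $\xi_0$ with finite second moment and every law of the initial modes $(\theta_{-1},\theta_0)$ and $\eta_0$. The plant is called * *mean square stabilizable with one-time-step-delayed observation of the actuation channel mode* if there are gains $F_1,\dots,F_N$ such that the plant with $u_k=F_{\theta_{k-1}}x_k$, i.e. $x_{k+1}=(A+\nu_kBF_{\theta_{k-1}})x_k+Gw_k$, is mean square stable; * *mean square detectable with respect to the sensing channel* if there are gains $M_1,\dots,M_I$ such that the operator $\mathcal V$ on $I$-tuples $S=(S_m)$ of matrices of the size of $A$, $$\mathcal V_n(S)=\hat\gamma_n(A+M_nL)\Big(\sum_{m}q_{mn}S_m\Big)(A+M_nL)^*+(1-\hat\gamma_n)A\Big(\sum_{m}q_{mn}S_m\Big)A^*,$$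 has spectral radius $\rho(\mathcal V)<1$. Connect the plant with the Luenberger-like observer $$\tilde x_{k+1}=A\tilde x_k+\nu_kBu_k-M_{\eta_k}(y_k-\gamma_kL\tilde x_k),\qquad u_k=F_{\theta_{k-1}}\tilde x_k,$$ and let $e_k=x_k-\tilde x_k$. The closed loop in the joint state $(x_k,e_k)$ is $$\begin{bmatrix}x_{k+1}\\e_{k+1}\end{bmatrix}=\begin{bmatrix}A+\nu_kBF_{\theta_{k-1}}&-\nu_kBF_{\theta_{k-1}}\\0&A+\gamma_kM_{\eta_k}L\end{bmatrix}\begin{bmatrix}x_k\\e_k\end{bmatrix}+\begin{bmatrix}G\\G+\gamma_kM_{\eta_k}H\end{bmatrix}w_k .$$ **Theorem (separation principle).** The closed loop can be made mean square stable, i.e. there are gains $F_1,\dots,F_N$ and $M_1,\dots,M_I$ for which it is mean square stable, if and only if the plant is mean square detectable with respect to the sensing channel and mean square stabilizable with one-time-step-delayed observation of the actuation channel mode. -/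

import Mathlib

open MeasureTheory ProbabilityTheory Filter Topology

noncomputable section

namespace NetworkedControl

/-- The matrices of the plant
`x_{k+1} = A x_k + ν_k B u_k + G w_k`, `y_k = γ_k L x_k + γ_k H w_k`,
over `𝕜 = ℝ` or `ℂ`. -/
structure Plant (𝕜 : Type) [RCLike 𝕜] (nx nu ny nw : ℕ) where
  A : Matrix (Fin nx) (Fin nx) 𝕜
  B : Matrix (Fin nx) (Fin nu) 𝕜
  G : Matrix (Fin nx) (Fin nw) 𝕜
  L : Matrix (Fin ny) (Fin nx) 𝕜
  H : Matrix (Fin ny) (Fin nw) 𝕜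

/-- A finite-state Markov channel: a transition probability matrix `P`, the probability
`deliver i` that a packet sent in mode `i` is delivered, and ergodicity: from every initial mode
the law of the mode converges to one and the same steady state distribution. -/
structure MarkovChannel (N : ℕ) where
  P : Matrix (Fin N) (Fin N) ℝ
  P_nonneg : ∀ i j, 0 ≤ P i j
  P_sum : ∀ i, ∑ j, P i j = 1
  deliver : Fin N → ℝ
  deliver_nonneg : ∀ i, 0 ≤ deliver i
  deliver_le_one : ∀ i, deliver i ≤ 1
  ergodic : ∃ π ∈ stdSimplex ℝ (Fin N),
    ∀ i j, Tendsto (fun k : ℕ => (P ^ k) i j) atTop (𝓝 (π j))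

/-- Conditional probability of delivery (`b = true`) or loss (`b = false`) in mode `i`. -/
def MarkovChannel.packetProb {N : ℕ} (ch : MarkovChannel N) (i : Fin N) (b : Bool) : ℝ :=
  if b then ch.deliver i else 1 - ch.deliver i

/-- The value `1` or `0` of a packet indicator. -/
def bit (𝕜 : Type) [RCLike 𝕜] (b : Bool) : 𝕜 := if b then 1 else 0

/-- `(recv k, mode k)`, `k = 0, 1, …`, is a run of the channel `ch`: the modes form a Markov chain
with transition matrix `ch.P`, and, given the mode at time `k`, delivery at time `k` has probability
`ch.deliver (mode k)` and is independent of everything else in the channel.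
The initial law is arbitrary. `past` is whatever of the channel was observed before time `0`;
given `mode 0` it has no influence on the run. -/
structure IsChannelRun {N : ℕ} (ch : MarkovChannel N) {Ω α : Type} [MeasurableSpace Ω]
    [MeasurableSpace α] (Pr : Measure Ω) (past : Ω → α) (mode : ℕ → Ω → Fin N)
    (recv : ℕ → Ω → Bool) : Prop where
  measurable_past : Measurable past
  measurable_mode : ∀ k, Measurable (mode k)
  measurable_recv : ∀ k, Measurable (recv k)
  path_zero : ∀ (a : α) (i : Fin N) (b : Bool),
    Pr.real {ω | past ω = a ∧ mode 0 ω = i ∧ recv 0 ω = b} =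
      Pr.real {ω | past ω = a ∧ mode 0 ω = i} * ch.packetProb i b
  path_succ : ∀ (k : ℕ) (a : α) (i : ℕ → Fin N) (b : ℕ → Bool),
    Pr.real {ω | past ω = a ∧ ∀ t ≤ k + 1, mode t ω = i t ∧ recv t ω = b t} =
      Pr.real {ω | past ω = a ∧ ∀ t ≤ k, mode t ω = i t ∧ recv t ω = b t} *
        (ch.P (i k) (i (k + 1)) * ch.packetProb (i (k + 1)) (b (k + 1)))

/-- `W` is the law of a white noise sequence `w_0, w_1, …`:
`E w_k = 0`, `E w_k w_k^* = 1` and `E w_k w_l^* = 0` for `k ≠ l`. -/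
structure IsWhiteNoise {𝕜 : Type} [RCLike 𝕜] {nw : ℕ} (W : Measure (ℕ → Fin nw → 𝕜)) : Prop where
  isProbabilityMeasure : IsProbabilityMeasure W
  memLp : ∀ k i, MemLp (fun w : ℕ → Fin nw → 𝕜 => w k i) 2 W
  mean : ∀ k i, ∫ w, w k i ∂W = 0
  covariance : ∀ k l i j, ∫ w, w k i * star (w l j) ∂W = if k = l ∧ i = j then 1 else 0

/-- The operational mode at time `k`: `(ν_k, θ_k)`, `θ_{k-1}` and `(γ_k, η_k)`. -/
structure Mode (N I : ℕ) where
  ν : Bool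
  θ : Fin N
  θprev : Fin N
  γ : Bool
  η : Fin I

/-- The random data that drive the system on a probability space `(Ω, Pr)`: a square integrable
initial state `x0` (with index set `s`), runs `(ν, θ)` and `(γ, η)` of the actuation and the sensing
channel, the actuation mode `θpast` at time `-1`, and a noise `w` of law `W`;
`x0`, the two runs and the noise are independent. The laws of `x0`, of `(θ_{-1}, θ_0)` and
of `η_0` are otherwise arbitrary. -/
structure Realization {𝕜 : Type} [RCLike 𝕜] {N I nw : ℕ} (act : MarkovChannel N)
    (sen : MarkovChannel I) (W : Measure (ℕ → Fin nw → 𝕜)) (s : Type) [Fintype s]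
    {Ω : Type} [MeasurableSpace Ω] (Pr : Measure Ω) where
  x0 : Ω → s → 𝕜
  θpast : Ω → Fin N
  θ : ℕ → Ω → Fin N
  ν : ℕ → Ω → Bool
  η : ℕ → Ω → Fin I
  γ : ℕ → Ω → Bool
  w : ℕ → Ω → Fin nw → 𝕜
  measurable_x0 : Measurable x0
  memLp_x0 : MemLp x0 2 Pr
  actuation : IsChannelRun act Pr θpast θ ν
  sensing : IsChannelRun sen Pr (fun _ => ()) η γ
  measurable_w : ∀ k, Measurable (w k)
  law_w : Pr.map (fun ω k => w k ω) = W
  indep_act : IndepFun x0 (fun ω => (θpast ω, fun k => (θ k ω, ν k ω))) Pr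
  indep_sen : IndepFun (fun ω => (x0 ω, θpast ω, fun k => (θ k ω, ν k ω)))
    (fun ω k => (η k ω, γ k ω)) Pr
  indep_w : IndepFun
    (fun ω => (x0 ω, (θpast ω, fun k => (θ k ω, ν k ω)), fun k => (η k ω, γ k ω)))
    (fun ω k => w k ω) Pr

section Dynamics

variable {𝕜 : Type} [RCLike 𝕜] {N I nw : ℕ} {act : MarkovChannel N} {sen : MarkovChannel I}
  {W : Measure (ℕ → Fin nw → 𝕜)} {s : Type} [Fintype s] {Ω : Type} [MeasurableSpace Ω]
  {Pr : Measure Ω}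

/-- The operational mode at time `k`. -/
def Realization.mode (R : Realization act sen W s Pr) (k : ℕ) (ω : Ω) : Mode N I where
  ν := R.ν k ω
  θ := R.θ k ω
  θprev := match k with
    | 0 => R.θpast ω
    | k + 1 => R.θ k ω
  γ := R.γ k ω
  η := R.η k ω

/-- The trajectory of the Markov jump linear system
`x_{k+1} = Γ(mode_k) x_k + S(mode_k) w_k`. -/
def Realization.state (R : Realization act sen W s Pr) (Γ : Mode N I → Matrix s s 𝕜)
    (S : Mode N I → Matrix s (Fin nw) 𝕜) : ℕ → Ω → s → 𝕜
  | 0, ω => R.x0 ω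
  | k + 1, ω => (Γ (R.mode k ω)).mulVec (R.state Γ S k ω) + (S (R.mode k ω)).mulVec (R.w k ω)

end Dynamics

/-- Mean square stability of `x_{k+1} = Γ(mode_k) x_k + S(mode_k) w_k`: there are `μe` and `Qe` such
that, for every initial condition, `E x_k → μe` and `E x_k x_k^* → Qe`.
(All the expectations exist, since `x_0` and the noise are square integrable and there are finitely
many modes.) -/
def MeanSquareStable {𝕜 : Type} [RCLike 𝕜] {N I nw : ℕ} (act : MarkovChannel N)
    (sen : MarkovChannel I) (W : Measure (ℕ → Fin nw → 𝕜)) {s : Type} [Fintype s]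
    (Γ : Mode N I → Matrix s s 𝕜) (S : Mode N I → Matrix s (Fin nw) 𝕜) : Prop :=
  ∃ (μe : s → 𝕜) (Qe : Matrix s s 𝕜),
    ∀ (Ω : Type) [MeasurableSpace Ω] (Pr : Measure Ω) [IsProbabilityMeasure Pr]
      (R : Realization act sen W s Pr),
      Tendsto (fun (k : ℕ) (i : s) => ∫ ω, R.state Γ S k ω i ∂Pr) atTop (𝓝 μe) ∧
      Tendsto (fun k : ℕ => Matrix.of fun i j : s =>
        ∫ ω, R.state Γ S k ω i * star (R.state Γ S k ω j) ∂Pr) atTop (𝓝 Qe)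

section Plant

variable {𝕜 : Type} [RCLike 𝕜] {nx nu ny nw N I : ℕ}

/-- Next state of the plant. -/
def Plant.next (p : Plant 𝕜 nx nu ny nw) (ν : Bool) (x : Fin nx → 𝕜) (u : Fin nu → 𝕜)
    (w : Fin nw → 𝕜) : Fin nx → 𝕜 :=
  p.A.mulVec x + bit 𝕜 ν • p.B.mulVec u + p.G.mulVec w

/-- Measurement received by the controller. -/
def Plant.output (p : Plant 𝕜 nx nu ny nw) (γ : Bool) (x : Fin nx → 𝕜) (w : Fin nw → 𝕜) :
    Fin ny → 𝕜 :=
  bit 𝕜 γ • p.L.mulVec x + bit 𝕜 γ • p.H.mulVec w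

/-- Next state of the Luenberger like observer with gain `M`:
`x̃⁺ = A x̃ + ν B u - M (y - γ L x̃)`. -/
def Plant.observerNext (p : Plant 𝕜 nx nu ny nw) (M : Matrix (Fin nx) (Fin ny) 𝕜) (ν γ : Bool)
    (xt : Fin nx → 𝕜) (u : Fin nu → 𝕜) (y : Fin ny → 𝕜) : Fin nx → 𝕜 :=
  p.A.mulVec xt + bit 𝕜 ν • p.B.mulVec u - M.mulVec (y - bit 𝕜 γ • p.L.mulVec xt)

/-- State matrix of the plant under the state feedback `u_k = F_{θ_{k-1}} x_k`. -/
def Plant.feedbackΓ (p : Plant 𝕜 nx nu ny nw) (F : Fin N → Matrix (Fin nu) (Fin nx) 𝕜)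
    (m : Mode N I) : Matrix (Fin nx) (Fin nx) 𝕜 :=
  p.A + bit 𝕜 m.ν • (p.B * F m.θprev)

/-- State matrix of the closed loop of plant, observer and `u_k = F_{θ_{k-1}} x̃_k`,
in the joint state `(x_k, e_k)`, `e_k = x_k - x̃_k`. -/
def Plant.closedLoopΓ (p : Plant 𝕜 nx nu ny nw) (F : Fin N → Matrix (Fin nu) (Fin nx) 𝕜)
    (M : Fin I → Matrix (Fin nx) (Fin ny) 𝕜) (m : Mode N I) :
    Matrix (Fin nx ⊕ Fin nx) (Fin nx ⊕ Fin nx) 𝕜 :=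
  Matrix.fromBlocks (p.A + bit 𝕜 m.ν • (p.B * F m.θprev)) (-(bit 𝕜 m.ν • (p.B * F m.θprev)))
    0 (p.A + bit 𝕜 m.γ • (M m.η * p.L))

/-- Noise matrix of the closed loop. -/
def Plant.closedLoopS (p : Plant 𝕜 nx nu ny nw) (M : Fin I → Matrix (Fin nx) (Fin ny) 𝕜)
    (m : Mode N I) : Matrix (Fin nx ⊕ Fin nx) (Fin nw) 𝕜 :=
  Matrix.fromRows p.G (p.G + bit 𝕜 m.γ • (M m.η * p.H))

/-- The plant with `u = F_{θ_{k-1}} x`. -/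
theorem Plant.next_feedback (p : Plant 𝕜 nx nu ny nw)
    (F : Fin N → Matrix (Fin nu) (Fin nx) 𝕜) (m : Mode N I) (x : Fin nx → 𝕜) (w : Fin nw → 𝕜) :
    p.next m.ν x ((F m.θprev).mulVec x) w = (p.feedbackΓ F m).mulVec x + p.G.mulVec w := by
  simp [Plant.next, Plant.feedbackΓ, Matrix.add_mulVec, Matrix.smul_mulVec, Matrix.mulVec_mulVec]

/-- The plant and the observer, connected by `u = F_{θ_{k-1}} x̃`, in the state `(x, x - x̃)`. -/
theorem Plant.next_closedLoop (p : Plant 𝕜 nx nu ny nw)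
    (F : Fin N → Matrix (Fin nu) (Fin nx) 𝕜) (M : Fin I → Matrix (Fin nx) (Fin ny) 𝕜)
    (m : Mode N I) (x xt : Fin nx → 𝕜) (w : Fin nw → 𝕜) :
    Sum.elim (p.next m.ν x ((F m.θprev).mulVec xt) w)
      (p.next m.ν x ((F m.θprev).mulVec xt) w -
        p.observerNext (M m.η) m.ν m.γ xt ((F m.θprev).mulVec xt) (p.output m.γ x w)) =
    (p.closedLoopΓ F M m).mulVec (Sum.elim x (x - xt)) + (p.closedLoopS M m).mulVec w := by
  rw [Plant.closedLoopΓ, Plant.closedLoopS, Matrix.fromBlocks_mulVec, Matrix.fromRows_mulVec]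
  simp only [Sum.elim_comp_inl, Sum.elim_comp_inr, Plant.next, Plant.observerNext, Plant.output,
    Matrix.add_mulVec, Matrix.smul_mulVec, Matrix.mulVec_sub, Matrix.mulVec_add,
    Matrix.mulVec_smul, Matrix.neg_mulVec, Matrix.zero_mulVec, ← Matrix.mulVec_mulVec]
  ext (i | i) <;>
    simp only [Sum.elim_inl, Sum.elim_inr, Pi.add_apply, Pi.sub_apply, Pi.neg_apply,
      Pi.smul_apply, Pi.zero_apply, smul_eq_mul] <;> ring

/-- Mean square stabilizability with one time step delayed observation of the actuation mode. -/
def Plant.MSStabilizable (p : Plant 𝕜 nx nu ny nw) (act : MarkovChannel N)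
    (sen : MarkovChannel I) (W : Measure (ℕ → Fin nw → 𝕜)) : Prop :=
  ∃ F : Fin N → Matrix (Fin nu) (Fin nx) 𝕜,
    MeanSquareStable act sen W (p.feedbackΓ F) (fun _ => p.G)

/-- `𝒟_n(S) = ∑_m q_{mn} S_m`. -/
def averageModes (sen : MarkovChannel I) (S : Fin I → Matrix (Fin nx) (Fin nx) 𝕜) (n : Fin I) :
    Matrix (Fin nx) (Fin nx) 𝕜 :=
  ∑ m, (sen.P m n : 𝕜) • S m

/-- The operator
`𝒱_n(S) = γ̂_n Γ_{n1} 𝒟_n(S) Γ_{n1}^* + (1 - γ̂_n) Γ_{n0} 𝒟_n(S) Γ_{n0}^*`. -/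
def secondMomentOp (sen : MarkovChannel I) (Γ1 Γ0 : Fin I → Matrix (Fin nx) (Fin nx) 𝕜) :
    Module.End 𝕜 (Fin I → Matrix (Fin nx) (Fin nx) 𝕜) where
  toFun S n :=
    (sen.deliver n : 𝕜) • (Γ1 n * averageModes sen S n * (Γ1 n).conjTranspose) +
      ((1 - sen.deliver n : ℝ) : 𝕜) • (Γ0 n * averageModes sen S n * (Γ0 n).conjTranspose)
  map_add' S T := by
    funext n
    simp only [averageModes, Pi.add_apply, smul_add, Finset.sum_add_distrib, Matrix.mul_add,
      Matrix.add_mul]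
    abel
  map_smul' c S := by
    have h : ∀ n, averageModes sen (c • S) n = c • averageModes sen S n := fun n => by
      simp only [averageModes, Pi.smul_apply, Finset.smul_sum]
      exact Finset.sum_congr rfl fun m _ => smul_comm _ _ _
    funext n
    simp only [h, Matrix.mul_smul, Matrix.smul_mul, Pi.smul_apply, smul_add, RingHom.id_apply]
    congr 1 <;> exact smul_comm _ _ _

/-- The spectral radius of an endomorphism of a finite-dimensional space over `ℝ` or `ℂ`: the
largest absolute value of its eigenvalues. They are taken in `ℂ` also when `𝕜 = ℝ`, as usual, that
is, they are those of a matrix of the endomorphism, read as a complex matrix. -/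
def operatorRadius {E : Type} [AddCommGroup E] [Module 𝕜 E] [Module.Finite 𝕜 E]
    (T : Module.End 𝕜 E) : ENNReal :=
  spectralRadius ℂ
    ((LinearMap.toMatrix (Module.finBasis 𝕜 E) (Module.finBasis 𝕜 E) T).map (RCLike.map 𝕜 ℂ))

/-- Mean square detectability with respect to the sensing channel. -/
def Plant.MSDetectable (p : Plant 𝕜 nx nu ny nw) (sen : MarkovChannel I) : Prop :=
  ∃ M : Fin I → Matrix (Fin nx) (Fin ny) 𝕜,
    operatorRadius (secondMomentOp sen (fun n => p.A + M n * p.L) (fun _ => p.A)) < 1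

end Plant

end NetworkedControl

end

namespace NetworkedControl

section LinearStability

/-- A submultiplicative null sequence decays geometrically. -/
theorem exists_geometric_bound {a : ℕ → ℝ} (h0 : ∀ n, 0 ≤ a n)
    (hmul : ∀ m n, a (m + n) ≤ a m * a n) (ht : Tendsto a atTop (𝓝 0)) :
    ∃ C r : ℝ, 0 ≤ C ∧ 0 < r ∧ r < 1 ∧ ∀ n, a n ≤ C * r ^ n := by
  obtain ⟨q, hq, hq1⟩ : ∃ q : ℕ, a q < 1 / 2 ∧ 1 ≤ q :=
    ((ht.eventually (gt_mem_nhds (by norm_num : (0 : ℝ) < 1 / 2))).and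
      (eventually_ge_atTop 1)).exists
  have hq' : (1 : ℝ) ≤ q := by exact_mod_cast hq1
  set r : ℝ := 1 + -(1 / (2 * q)) with hr
  have hpos : 0 < 1 / (2 * (q : ℝ)) := by positivity
  have hle : 1 / (2 * (q : ℝ)) ≤ 1 / 2 := by
    apply one_div_le_one_div_of_le <;> linarith
  have hr0 : 0 < r := by rw [hr]; linarith
  have hrq : a q ≤ r ^ q := by
    have := one_add_mul_le_pow (a := -(1 / (2 * (q : ℝ)))) (by linarith) q
    have e : (q : ℝ) * -(1 / (2 * q)) = -(1 / 2) := by field_simp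
    rw [e] at this
    rw [hr]; linarith
  set C : ℝ := ∑ j ∈ Finset.range q, a j / r ^ j with hC
  have hterm : ∀ j, 0 ≤ a j / r ^ j := fun j => div_nonneg (h0 j) (pow_nonneg hr0.le j)
  have hC0 : 0 ≤ C := Finset.sum_nonneg fun j _ => hterm j
  refine ⟨C, r, hC0, hr0, by rw [hr]; linarith, fun n => ?_⟩
  induction n using Nat.strong_induction_on with
  | _ n ih =>
    rcases lt_or_ge n q with h | h
    · have h1 : a n / r ^ n ≤ C :=
        Finset.single_le_sum (f := fun j => a j / r ^ j) (fun j _ => hterm j)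
          (Finset.mem_range.2 h)
      rwa [div_le_iff₀ (pow_pos hr0 n)] at h1
    · obtain ⟨m, rfl⟩ := Nat.exists_eq_add_of_le h
      calc a (q + m) ≤ a q * a m := hmul q m
        _ ≤ r ^ q * (C * r ^ m) :=
          mul_le_mul hrq (ih m (by omega)) (h0 m) (pow_nonneg hr0.le q)
        _ = C * r ^ (q + m) := by ring

variable {𝕜 : Type} [RCLike 𝕜] {E : Type} [NormedAddCommGroup E] [NormedSpace 𝕜 E]
  [FiniteDimensional 𝕜 E]

/-- If the powers of an endomorphism of a finite-dimensional space tend to zero pointwise, then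
they do so geometrically. -/
theorem exists_norm_pow_le (T : Module.End 𝕜 E)
    (h : ∀ x, Tendsto (fun k : ℕ => (T ^ k) x) atTop (𝓝 0)) :
    ∃ C r : ℝ, 0 ≤ C ∧ 0 < r ∧ r < 1 ∧ ∀ (k : ℕ) (x : E), ‖(T ^ k) x‖ ≤ C * r ^ k * ‖x‖ := by
  have hcomp : CompleteSpace E := FiniteDimensional.complete 𝕜 E
  let S : ℕ → E →L[𝕜] E := fun k => LinearMap.toContinuousLinearMap (T ^ k)
  have hS : ∀ k x, S k x = (T ^ k) x := fun k x => rfl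
  have hlim : Tendsto (fun k => ‖S k‖) atTop (𝓝 0) := by
    obtain ⟨C, hC, hb⟩ := (Module.finBasis 𝕜 E).exists_opNorm_le (F := E)
    have hsum : Tendsto (fun k => C * ∑ i, ‖(T ^ k) (Module.finBasis 𝕜 E i)‖) atTop (𝓝 0) := by
      have : Tendsto (fun k => C * ∑ i, ‖(T ^ k) (Module.finBasis 𝕜 E i)‖) atTop
          (𝓝 (C * ∑ i : Fin (Module.finrank 𝕜 E), ‖(0 : E)‖)) :=
        (tendsto_finsetSum _ fun i _ => (h _).norm).const_mul C
      simpa using this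
    refine squeeze_zero (fun k => norm_nonneg _) (fun k => ?_) hsum
    refine hb (Finset.sum_nonneg fun i _ => norm_nonneg _) fun i => ?_
    exact Finset.single_le_sum (f := fun i => ‖(T ^ k) (Module.finBasis 𝕜 E i)‖)
      (fun i _ => norm_nonneg _) (Finset.mem_univ i)
  obtain ⟨C, r, hC, hr0, hr1, hb⟩ := exists_geometric_bound (a := fun k => ‖S k‖)
    (fun k => norm_nonneg _) (fun m n => by
      have : S (m + n) = (S m).comp (S n) := by
        ext x; simp [hS, pow_add]
      rw [this]
      exact ContinuousLinearMap.opNorm_comp_le _ _) hlim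
  exact ⟨C, r, hC, hr0, hr1, fun k x => ((S k).le_opNorm x).trans
    (mul_le_mul_of_nonneg_right (hb k) (norm_nonneg x))⟩

/-- A stable affine recursion with convergent input converges, to a limit that only depends on
the limit of the input. -/
theorem exists_tendsto_of_affine_recursion (T : Module.End 𝕜 E)
    (h : ∀ x, Tendsto (fun k : ℕ => (T ^ k) x) atTop (𝓝 0)) (u : E) :
    ∃ L : E, ∀ X v : ℕ → E, (∀ k, X (k + 1) = T (X k) + v k) → Tendsto v atTop (𝓝 u) →
      Tendsto X atTop (𝓝 L) := by
  have hcomp : CompleteSpace E := FiniteDimensional.complete 𝕜 E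
  have hcont : ∀ l, Continuous ⇑(T ^ l) := fun l =>
    LinearMap.continuous_of_finiteDimensional (T ^ l)
  obtain ⟨C, r, hC, hr0, hr1, hb⟩ := exists_norm_pow_le T h
  refine ⟨∑' l, (T ^ l) u, fun X v hX hv => ?_⟩
  have hform : ∀ k, X k = (T ^ k) (X 0) + ∑ l ∈ Finset.range k, (T ^ l) (v (k - 1 - l)) := by
    intro k
    induction k with
    | zero => simp
    | succ k ih =>
      rw [hX, ih, Finset.sum_range_succ', map_add, map_sum, add_assoc]
      congr 1
      · rw [pow_succ', Module.End.mul_apply]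
      · congr 1
        refine Finset.sum_congr rfl fun l hl => ?_
        rw [pow_succ', Module.End.mul_apply]
        congr 3
        omega
  obtain ⟨D, hD⟩ : ∃ D, ∀ k, ‖v k‖ ≤ D := by
    obtain ⟨D, hD⟩ := hv.norm.bddAbove_range
    exact ⟨D, fun k => hD ⟨k, rfl⟩⟩
  have hD0 : 0 ≤ D := (norm_nonneg _).trans (hD 0)
  let f : ℕ → ℕ → E := fun k l => if l < k then (T ^ l) (v (k - 1 - l)) else 0
  have hf : ∀ k, ∑' l, f k l = ∑ l ∈ Finset.range k, (T ^ l) (v (k - 1 - l)) := by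
    intro k
    rw [tsum_eq_sum (s := Finset.range k) fun l hl => if_neg (by simpa using hl)]
    exact Finset.sum_congr rfl fun l hl => if_pos (Finset.mem_range.1 hl)
  have key : Tendsto (fun k => ∑' l, f k l) atTop (𝓝 (∑' l, (T ^ l) u)) := by
    refine tendsto_tsum_of_dominated_convergence (bound := fun l => C * r ^ l * D)
      (((summable_geometric_of_lt_one hr0.le hr1).mul_left C).mul_right D) (fun l => ?_)
      (Eventually.of_forall fun k l => ?_)
    · have h1 : Tendsto (fun k => (T ^ l) (v (k - 1 - l))) atTop (𝓝 ((T ^ l) u)) := by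
        refine ((hcont l).tendsto u).comp (hv.comp ?_)
        exact (tendsto_sub_atTop_nat l).comp (tendsto_sub_atTop_nat 1)
      refine h1.congr' ?_
      filter_upwards [eventually_gt_atTop l] with k hk
      exact (if_pos hk).symm
    · by_cases hk : l < k
      · simp only [f, if_pos hk]
        exact (hb l _).trans (mul_le_mul_of_nonneg_left (hD _) (by positivity))
      · simp only [f, if_neg hk, norm_zero]
        positivity
  have := (h (X 0)).add key
  rw [zero_add] at this
  refine this.congr fun k => ?_
  rw [hf, ← hform]

theorem rclike_map_mul (a b : 𝕜) :
    RCLike.map 𝕜 ℂ (a * b) = RCLike.map 𝕜 ℂ a * RCLike.map 𝕜 ℂ b := by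
  apply Complex.ext <;> simp [RCLike.map_apply]

theorem rclike_map_one : RCLike.map 𝕜 ℂ (1 : 𝕜) = 1 := by
  simp [RCLike.map_apply]

/-- The complexification of scalars as a ring homomorphism. -/
noncomputable def complexify (𝕜 : Type) [RCLike 𝕜] : 𝕜 →+* ℂ where
  toFun := RCLike.map 𝕜 ℂ
  map_one' := rclike_map_one
  map_mul' := rclike_map_mul
  map_zero' := map_zero _
  map_add' := map_add _

theorem norm_complexify (a : 𝕜) : ‖complexify 𝕜 a‖ = ‖a‖ := by
  have h : ‖complexify 𝕜 a‖ ^ 2 = ‖a‖ ^ 2 := by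
    rw [← Complex.normSq_eq_norm_sq, ← RCLike.normSq_eq_def', RCLike.normSq_apply,
      Complex.normSq_apply]
    simp [complexify, RCLike.map_apply]
  exact (pow_left_inj₀ (norm_nonneg _) (norm_nonneg _) two_ne_zero).1 h

attribute [local instance] Matrix.linftyOpNormedRing Matrix.linftyOpNormedAlgebra in
/-- The powers of a complex matrix tend to zero iff its spectral radius is less than one. -/
theorem spectralRadius_lt_one_iff {d : ℕ} (N : Matrix (Fin d) (Fin d) ℂ) :
    spectralRadius ℂ N < 1 ↔ Tendsto (fun k : ℕ => N ^ k) atTop (𝓝 0) := by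
  have hcomp : CompleteSpace (Matrix (Fin d) (Fin d) ℂ) := FiniteDimensional.complete ℂ _
  constructor
  · intro h
    obtain ⟨r, hr, hr1⟩ := ENNReal.lt_iff_exists_nnreal_btwn.1 h
    have hr1' : (r : ℝ) < 1 := by exact_mod_cast hr1
    have h2 := (spectrum.pow_nnnorm_pow_one_div_tendsto_nhds_spectralRadius N).eventually
      (gt_mem_nhds hr)
    refine tendsto_zero_iff_norm_tendsto_zero.2 ?_
    refine squeeze_zero' (Eventually.of_forall fun k => norm_nonneg _) ?_
      (tendsto_pow_atTop_nhds_zero_of_lt_one r.2 hr1')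
    filter_upwards [h2, eventually_ge_atTop 1] with k hk hk1
    have hk0 : (k : ℝ) ≠ 0 := by positivity
    have h3 : ((‖N ^ k‖₊ : ENNReal) ^ (1 / k : ℝ)) ^ (k : ℝ) ≤ (r : ENNReal) ^ (k : ℝ) :=
      ENNReal.rpow_le_rpow hk.le (by positivity)
    rw [← ENNReal.rpow_mul, one_div_mul_cancel hk0, ENNReal.rpow_one, ENNReal.rpow_natCast] at h3
    exact_mod_cast h3
  · intro h
    rcases isEmpty_or_nonempty (Fin d) with hd | hd
    · have : Subsingleton (Matrix (Fin d) (Fin d) ℂ) := inferInstance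
      rw [spectrum.SpectralRadius.of_subsingleton]
      exact zero_lt_one
    · have hnorm : Tendsto (fun k : ℕ => ‖N ^ k‖) atTop (𝓝 0) :=
        tendsto_zero_iff_norm_tendsto_zero.1 h
      have hne : (spectrum ℂ N).Nonempty := spectrum.nonempty N
      rw [← ENNReal.coe_one]
      refine spectrum.spectralRadius_lt_of_forall_lt_of_nonempty hne fun z hz => ?_
      by_contra hz1
      rw [not_lt] at hz1
      obtain ⟨k, hk⟩ := ((hnorm.mul_const ‖(1 : Matrix (Fin d) (Fin d) ℂ)‖).eventually
        (gt_mem_nhds (by simp : 0 * ‖(1 : Matrix (Fin d) (Fin d) ℂ)‖ < 1))).exists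
      have h4 : ‖z ^ k‖ ≤ ‖N ^ k‖ * ‖(1 : Matrix (Fin d) (Fin d) ℂ)‖ :=
        spectrum.norm_le_norm_mul_of_mem (spectrum.pow_mem_pow N k hz)
      have h5 : (1 : ℝ) ≤ ‖z ^ k‖ := by
        rw [norm_pow]
        exact one_le_pow₀ (by exact_mod_cast hz1)
      linarith

/-- An endomorphism of a finite-dimensional space is stable iff its spectral radius is less
than one. -/
theorem operatorRadius_lt_one_iff (T : Module.End 𝕜 E) :
    operatorRadius T < 1 ↔ ∀ x, Tendsto (fun k : ℕ => (T ^ k) x) atTop (𝓝 0) := by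
  classical
  set b := Module.finBasis 𝕜 E with hb
  have hentry : ∀ (k : ℕ) i j,
      (((LinearMap.toMatrix b b T).map (RCLike.map 𝕜 ℂ)) ^ k) i j =
        complexify 𝕜 (b.repr ((T ^ k) (b j)) i) := by
    intro k i j
    have h1 : (LinearMap.toMatrix b b T).map (RCLike.map 𝕜 ℂ) =
        (complexify 𝕜).mapMatrix (LinearMap.toMatrix b b T) := rfl
    have h2 : (LinearMap.toMatrix b b T) ^ k = LinearMap.toMatrix b b (T ^ k) :=
      (map_pow (LinearMap.toMatrixAlgEquiv b) T k).symm
    rw [h1, ← map_pow, h2, RingHom.mapMatrix_apply, Matrix.map_apply, LinearMap.toMatrix_apply]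
  rw [operatorRadius, spectralRadius_lt_one_iff]
  have hmat : Tendsto (fun k : ℕ => ((LinearMap.toMatrix b b T).map (RCLike.map 𝕜 ℂ)) ^ k) atTop
      (𝓝 0) ↔ ∀ i j, Tendsto (fun k : ℕ => b.repr ((T ^ k) (b j)) i) atTop (𝓝 0) := by
    refine tendsto_pi_nhds.trans (forall_congr' fun i => ?_)
    refine tendsto_pi_nhds.trans (forall_congr' fun j => ?_)
    simp only [hentry, Matrix.zero_apply]
    rw [tendsto_zero_iff_norm_tendsto_zero, tendsto_zero_iff_norm_tendsto_zero (E := 𝕜)]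
    simp only [norm_complexify]
  rw [hmat]
  constructor
  · intro h x
    have h1 : ∀ j, Tendsto (fun k : ℕ => (T ^ k) (b j)) atTop (𝓝 0) := by
      intro j
      have h2 : Tendsto (fun k : ℕ => ∑ i, b.repr ((T ^ k) (b j)) i • b i) atTop
          (𝓝 (∑ i, (0 : 𝕜) • b i)) := tendsto_finsetSum _ fun i _ => (h i j).smul_const _
      simpa [b.sum_repr] using h2
    have h3 : Tendsto (fun k : ℕ => ∑ j, b.repr x j • (T ^ k) (b j)) atTop
        (𝓝 (∑ j, b.repr x j • (0 : E))) := tendsto_finsetSum _ fun j _ => (h1 j).const_smul _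
    simp only [smul_zero, Finset.sum_const_zero] at h3
    refine h3.congr fun k => ?_
    conv_rhs => rw [← b.sum_repr x, map_sum]
    simp only [map_smul]
  · intro h i j
    have hc : Continuous (b.coord i) := LinearMap.continuous_of_finiteDimensional _
    have := (hc.tendsto 0).comp (h (b j))
    simpa [Function.comp_def] using this

end LinearStability

section JumpLinear

variable {𝕜 : Type} [RCLike 𝕜] {Z Λ s : Type} [Fintype Z] [Fintype Λ] [Fintype s]

/-- One step of the second moments of a jump linear system that moves from `z` to `z'` with label
`l` with probability `w z l z'`, multiplying the state by `Γ z l z'`. -/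
noncomputable def momentOp (w : Z → Λ → Z → ℝ) (Γ : Z → Λ → Z → Matrix s s 𝕜) :
    Module.End 𝕜 (Z → Matrix s s 𝕜) where
  toFun X z' := ∑ z, ∑ l, (w z l z' : 𝕜) • (Γ z l z' * X z * (Γ z l z').conjTranspose)
  map_add' X Y := by
    funext z'
    simp only [Pi.add_apply, Matrix.mul_add, Matrix.add_mul, smul_add, Finset.sum_add_distrib]
  map_smul' c X := by
    funext z'
    simp only [Pi.smul_apply, Matrix.mul_smul, Matrix.smul_mul, RingHom.id_apply,
      Finset.smul_sum]
    exact Finset.sum_congr rfl fun z _ => Finset.sum_congr rfl fun l _ => smul_comm _ _ _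

/-- The expected squared norm after `k` steps, from mode `z` and state `v`. -/
noncomputable def energy (w : Z → Λ → Z → ℝ) (Γ : Z → Λ → Z → Matrix s s 𝕜) :
    ℕ → Z → (s → 𝕜) → ℝ
  | 0, _, v => ∑ i, ‖v i‖ ^ 2
  | k + 1, z, v => ∑ z', ∑ l, w z l z' * energy w Γ k z' ((Γ z l z').mulVec v)

variable {w : Z → Λ → Z → ℝ} {Γ : Z → Λ → Z → Matrix s s 𝕜}

theorem energy_nonneg (hw : ∀ z l z', 0 ≤ w z l z') (k : ℕ) (z : Z) (v : s → 𝕜) :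
    0 ≤ energy w Γ k z v := by
  induction k generalizing z v with
  | zero => exact Finset.sum_nonneg fun i _ => by positivity
  | succ k ih =>
    exact Finset.sum_nonneg fun z' _ => Finset.sum_nonneg fun l _ => mul_nonneg (hw _ _ _) (ih _ _)

theorem energy_add_le (hw : ∀ z l z', 0 ≤ w z l z') {ε : ℝ} (hε : 0 < ε) (k : ℕ) (z : Z)
    (u v : s → 𝕜) :
    energy w Γ k z (u + v) ≤ (1 + 1 / ε) * energy w Γ k z u + (1 + ε) * energy w Γ k z v := by
  induction k generalizing z u v with
  | zero =>
    simp only [energy, Finset.mul_sum, ← Finset.sum_add_distrib]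
    refine Finset.sum_le_sum fun i _ => ?_
    have h1 : ‖u i + v i‖ ^ 2 ≤ (‖u i‖ + ‖v i‖) ^ 2 :=
      pow_le_pow_left₀ (norm_nonneg _) (norm_add_le _ _) 2
    have h2 : 0 ≤ 1 / ε * (‖u i‖ - ε * ‖v i‖) ^ 2 := by positivity
    have h3 : 1 / ε * (‖u i‖ - ε * ‖v i‖) ^ 2 =
        1 / ε * ‖u i‖ ^ 2 - 2 * (‖u i‖ * ‖v i‖) + ε * ‖v i‖ ^ 2 := by
      field_simp
      ring
    simp only [Pi.add_apply]
    nlinarith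
  | succ k ih =>
    simp only [energy, Finset.mul_sum, ← Finset.sum_add_distrib]
    refine Finset.sum_le_sum fun z' _ => Finset.sum_le_sum fun l _ => ?_
    rw [Matrix.mulVec_add]
    calc _ ≤ w z l z' * _ := mul_le_mul_of_nonneg_left (ih _ _ _) (hw _ _ _)
      _ = _ := by ring

/-- The rank one matrix `u v^*`. -/
def outer (u v : s → 𝕜) : Matrix s s 𝕜 := Matrix.of fun i j => u i * star (v j)

theorem mul_outer_mul (A : Matrix s s 𝕜) (u v : s → 𝕜) :
    A * outer u v * A.conjTranspose = outer (A.mulVec u) (A.mulVec v) := by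
  have h : ∀ u v : s → 𝕜, outer u v = Matrix.vecMulVec u (star v) := fun u v => rfl
  rw [h, h, Matrix.mul_vecMulVec, Matrix.vecMulVec_mul, Matrix.star_mulVec]

section DecEq

variable [DecidableEq Z]

theorem momentOp_single_outer (z : Z) (u v : s → 𝕜) :
    momentOp w Γ (Pi.single z (outer u v)) = ∑ z', ∑ l, (w z l z' : 𝕜) •
      (Pi.single z' (outer ((Γ z l z').mulVec u) ((Γ z l z').mulVec v)) : Z → Matrix s s 𝕜) := by
  funext z'
  have hL : momentOp w Γ (Pi.single z (outer u v)) z' =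
      ∑ l, (w z l z' : 𝕜) • outer ((Γ z l z').mulVec u) ((Γ z l z').mulVec v) := by
    simp only [momentOp, LinearMap.coe_mk, AddHom.coe_mk]
    rw [Finset.sum_eq_single z]
    · simp only [Pi.single_eq_same, mul_outer_mul]
    · intro y _ hy
      simp [Pi.single_eq_of_ne hy]
    · simp
  rw [hL, Finset.sum_apply, Finset.sum_eq_single z']
  · simp [Finset.sum_apply]
  · intro y _ hy
    simp [Finset.sum_apply, Pi.single_eq_of_ne hy.symm]
  · simp

theorem momentOp_pow_succ_single_outer (k : ℕ) (z : Z) (u v : s → 𝕜) :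
    (momentOp w Γ ^ (k + 1)) (Pi.single z (outer u v)) = ∑ z', ∑ l, (w z l z' : 𝕜) •
      (momentOp w Γ ^ k)
        (Pi.single z' (outer ((Γ z l z').mulVec u) ((Γ z l z').mulVec v))) := by
  rw [pow_succ, Module.End.mul_apply, momentOp_single_outer]
  simp only [map_sum, map_smul]

theorem norm_momentOp_pow_entry_le (hw : ∀ z l z', 0 ≤ w z l z') (k : ℕ) (z : Z) (u v : s → 𝕜)
    (y : Z) (i j : s) :
    ‖(momentOp w Γ ^ k) (Pi.single z (outer u v)) y i j‖ ≤ energy w Γ k z u + energy w Γ k z v := by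
  induction k generalizing z u v with
  | zero =>
    simp only [pow_zero, Module.End.one_apply, energy]
    have hu : ‖u i‖ ^ 2 ≤ ∑ i, ‖u i‖ ^ 2 :=
      Finset.single_le_sum (f := fun i => ‖u i‖ ^ 2) (fun _ _ => by positivity) (Finset.mem_univ i)
    have hv : ‖v j‖ ^ 2 ≤ ∑ i, ‖v i‖ ^ 2 :=
      Finset.single_le_sum (f := fun i => ‖v i‖ ^ 2) (fun _ _ => by positivity) (Finset.mem_univ j)
    by_cases h : y = z
    · subst h
      simp only [Pi.single_eq_same, outer, Matrix.of_apply, norm_mul, norm_star]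
      nlinarith [sq_nonneg (‖u i‖ - ‖v j‖), sq_nonneg (‖u i‖), sq_nonneg ‖v j‖]
    · simp only [Pi.single_eq_of_ne h, Matrix.zero_apply, norm_zero]
      nlinarith [sq_nonneg (‖u i‖), sq_nonneg ‖v j‖]
  | succ k ih =>
    rw [momentOp_pow_succ_single_outer]
    simp only [energy, ← Finset.sum_add_distrib, Finset.sum_apply, Matrix.sum_apply,
      Pi.smul_apply, Matrix.smul_apply]
    refine (norm_sum_le _ _).trans (Finset.sum_le_sum fun z' _ => ?_)
    refine (norm_sum_le _ _).trans (Finset.sum_le_sum fun l _ => ?_)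
    rw [norm_smul, RCLike.norm_ofReal, abs_of_nonneg (hw _ _ _), ← mul_add]
    exact mul_le_mul_of_nonneg_left (ih _ _ _) (hw _ _ _)

theorem energy_eq_sum_trace (k : ℕ) (z : Z) (v : s → 𝕜) :
    (energy w Γ k z v : 𝕜) = ∑ y, ((momentOp w Γ ^ k) (Pi.single z (outer v v)) y).trace := by
  induction k generalizing z v with
  | zero =>
    rw [Finset.sum_eq_single z]
    · simp [energy, Matrix.trace, outer, RCLike.mul_conj]
    · intro y _ hy
      simp [Pi.single_eq_of_ne hy]
    · simp
  | succ k ih =>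
    rw [momentOp_pow_succ_single_outer]
    simp only [energy, RCLike.ofReal_sum, RCLike.ofReal_mul, ih, Finset.sum_apply,
      Matrix.trace_sum, Pi.smul_apply, Matrix.trace_smul, smul_eq_mul, Finset.mul_sum]
    conv_rhs => rw [Finset.sum_comm]
    refine Finset.sum_congr rfl fun y _ => ?_
    conv_rhs => rw [Finset.sum_comm]

end DecEq

/-- The jump linear system is mean square stable without noise. -/
def EnergyStable (w : Z → Λ → Z → ℝ) (Γ : Z → Λ → Z → Matrix s s 𝕜) : Prop :=
  ∀ z v, Tendsto (fun k => energy w Γ k z v) atTop (𝓝 0)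

theorem energyStable_iff_momentOp (hw : ∀ z l z', 0 ≤ w z l z') :
    EnergyStable w Γ ↔ ∀ X, Tendsto (fun k : ℕ => (momentOp w Γ ^ k) X) atTop (𝓝 0) := by
  classical
  constructor
  · intro h X
    have hbase : ∀ z i j, Tendsto (fun k : ℕ => (momentOp w Γ ^ k)
        (Pi.single z (outer (Pi.single i 1) (Pi.single j (1 : 𝕜))))) atTop (𝓝 0) := by
      intro z i j
      refine tendsto_pi_nhds.2 fun y => tendsto_pi_nhds.2 fun a => tendsto_pi_nhds.2 fun b => ?_
      refine squeeze_zero_norm (fun k => norm_momentOp_pow_entry_le hw k _ _ _ y a b) ?_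
      simpa using (h z (Pi.single i 1)).add (h z (Pi.single j 1))
    have hX : X = ∑ z, ∑ i, ∑ j, X z i j •
        (Pi.single z (outer (Pi.single i 1) (Pi.single j (1 : 𝕜))) : Z → Matrix s s 𝕜) := by
      funext z
      ext i j
      simp only [Finset.sum_apply, Matrix.sum_apply, Pi.smul_apply, Matrix.smul_apply]
      rw [Finset.sum_eq_single z, Finset.sum_eq_single i, Finset.sum_eq_single j]
      · simp [outer]
      · intro b _ hb
        simp [outer, Pi.single_eq_of_ne hb.symm]
      · simp
      · intro b _ hb
        simp [outer, Pi.single_eq_of_ne hb.symm]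
      · simp
      · intro b _ hb
        simp [Pi.single_eq_of_ne hb.symm]
      · simp
    have key : Tendsto (fun k : ℕ => ∑ z, ∑ i, ∑ j, X z i j • (momentOp w Γ ^ k)
        (Pi.single z (outer (Pi.single i 1) (Pi.single j (1 : 𝕜))))) atTop
        (𝓝 (∑ z : Z, ∑ i, ∑ j, X z i j • 0)) :=
      tendsto_finsetSum _ fun z _ => tendsto_finsetSum _ fun i _ => tendsto_finsetSum _ fun j _ =>
        (hbase z i j).const_smul _
    simp only [smul_zero, Finset.sum_const_zero] at key
    refine key.congr fun k => ?_
    conv_rhs => rw [hX]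
    simp only [map_sum, map_smul]
  · intro h z v
    have h1 : Tendsto (fun k : ℕ => ∑ y, ∑ i,
        (momentOp w Γ ^ k) (Pi.single z (outer v v)) y i i) atTop
        (𝓝 (∑ y : Z, ∑ i : s, (0 : 𝕜))) :=
      tendsto_finsetSum _ fun y _ => tendsto_finsetSum _ fun i _ =>
        tendsto_pi_nhds.1 (tendsto_pi_nhds.1 (tendsto_pi_nhds.1 (h (Pi.single z (outer v v))) y) i) i
    simp only [Finset.sum_const_zero] at h1
    have h2 := h1.norm
    rw [norm_zero] at h2
    refine h2.congr fun k => ?_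
    have := energy_eq_sum_trace (w := w) (Γ := Γ) k z v
    simp only [Matrix.trace, Matrix.diag_apply] at this
    rw [← this, RCLike.norm_ofReal, abs_of_nonneg (energy_nonneg hw k z v)]

attribute [local instance] Matrix.normedAddCommGroup Matrix.normedSpace in
/-- The energies of a stable jump linear system decay geometrically. -/
theorem EnergyStable.exists_le (hw : ∀ z l z', 0 ≤ w z l z') (h : EnergyStable w Γ) :
    ∃ C r : ℝ, 0 ≤ C ∧ 0 < r ∧ r < 1 ∧
      ∀ k z v, energy w Γ k z v ≤ C * r ^ k * ∑ i, ‖v i‖ ^ 2 := by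
  classical
  obtain ⟨C, r, hC, hr0, hr1, hb⟩ := exists_norm_pow_le (momentOp w Γ)
    ((energyStable_iff_momentOp hw).1 h)
  refine ⟨Fintype.card Z * Fintype.card s * C, r, by positivity, hr0, hr1, fun k z v => ?_⟩
  have h1 : energy w Γ k z v =
      ‖∑ y, ∑ i, (momentOp w Γ ^ k) (Pi.single z (outer v v)) y i i‖ := by
    have := energy_eq_sum_trace (w := w) (Γ := Γ) k z v
    simp only [Matrix.trace, Matrix.diag_apply] at this
    rw [← this, RCLike.norm_ofReal, abs_of_nonneg (energy_nonneg hw k z v)]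
  have h2 : ‖(Pi.single z (outer v v) : Z → Matrix s s 𝕜)‖ ≤ ∑ i, ‖v i‖ ^ 2 := by
    have h0 : 0 ≤ ∑ i, ‖v i‖ ^ 2 := Finset.sum_nonneg fun i _ => by positivity
    rw [Pi.norm_single, Matrix.norm_le_iff h0]
    intro i j
    have hu : ‖v i‖ ^ 2 ≤ ∑ i, ‖v i‖ ^ 2 :=
      Finset.single_le_sum (f := fun i => ‖v i‖ ^ 2) (fun _ _ => by positivity) (Finset.mem_univ i)
    have hv : ‖v j‖ ^ 2 ≤ ∑ i, ‖v i‖ ^ 2 :=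
      Finset.single_le_sum (f := fun i => ‖v i‖ ^ 2) (fun _ _ => by positivity) (Finset.mem_univ j)
    simp only [outer, Matrix.of_apply, norm_mul, norm_star]
    nlinarith [sq_nonneg (‖v i‖ - ‖v j‖)]
  have h3 : ∀ y i, ‖(momentOp w Γ ^ k) (Pi.single z (outer v v)) y i i‖ ≤
      C * r ^ k * ∑ i, ‖v i‖ ^ 2 := fun y i =>
    ((Matrix.norm_entry_le_entrywise_sup_norm _).trans (norm_le_pi_norm _ y)).trans
      ((hb k _).trans (mul_le_mul_of_nonneg_left h2 (by positivity)))
  rw [h1]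
  calc _ ≤ ∑ y, ∑ i, ‖(momentOp w Γ ^ k) (Pi.single z (outer v v)) y i i‖ :=
        (norm_sum_le _ _).trans (Finset.sum_le_sum fun y _ => norm_sum_le _ _)
    _ ≤ ∑ y : Z, ∑ i : s, C * r ^ k * ∑ i, ‖v i‖ ^ 2 :=
        Finset.sum_le_sum fun y _ => Finset.sum_le_sum fun i _ => h3 y i
    _ = _ := by simp only [Finset.sum_const, Finset.card_univ, nsmul_eq_mul]; ring

end JumpLinear

section Triangular

variable {𝕜 : Type} [RCLike 𝕜] {Z Λ s t : Type} [Fintype Z] [Fintype Λ] [Fintype s] [Fintype t]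
  {w : Z → Λ → Z → ℝ} {A : Z → Λ → Z → Matrix s s 𝕜} {D : Z → Λ → Z → Matrix s t 𝕜}
  {E : Z → Λ → Z → Matrix t t 𝕜}

theorem fromBlocks_triangular_mulVec (A : Matrix s s 𝕜) (D : Matrix s t 𝕜) (E : Matrix t t 𝕜)
    (x : s → 𝕜) (e : t → 𝕜) :
    (Matrix.fromBlocks A D 0 E).mulVec (Sum.elim x e) =
      Sum.elim (A.mulVec x + D.mulVec e) (E.mulVec e) := by
  rw [Matrix.fromBlocks_mulVec]
  simp

theorem energy_fromBlocks_inl (k : ℕ) (z : Z) (x : s → 𝕜) :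
    energy w (fun z l z' => Matrix.fromBlocks (A z l z') (D z l z') 0 (E z l z')) k z
      (Sum.elim x 0) = energy w A k z x := by
  induction k generalizing z x with
  | zero => simp [energy]
  | succ k ih =>
    simp only [energy, fromBlocks_triangular_mulVec, Matrix.mulVec_zero, add_zero, ih]

theorem energy_le_energy_fromBlocks (hw : ∀ z l z', 0 ≤ w z l z') (k : ℕ) (z : Z) (x : s → 𝕜)
    (e : t → 𝕜) :
    energy w E k z e ≤
      energy w (fun z l z' => Matrix.fromBlocks (A z l z') (D z l z') 0 (E z l z')) k z
        (Sum.elim x e) := by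
  induction k generalizing z x e with
  | zero =>
    simp only [energy, Fintype.sum_sum_type, Sum.elim_inl, Sum.elim_inr]
    exact le_add_of_nonneg_left (Finset.sum_nonneg fun i _ => by positivity)
  | succ k ih =>
    simp only [energy, fromBlocks_triangular_mulVec]
    exact Finset.sum_le_sum fun z' _ => Finset.sum_le_sum fun l _ =>
      mul_le_mul_of_nonneg_left (ih _ _ _) (hw _ _ _)

theorem sum_norm_mulVec_sq_le (D : Matrix s t 𝕜) (e : t → 𝕜) :
    ∑ i, ‖D.mulVec e i‖ ^ 2 ≤ (∑ i, ∑ j, ‖D i j‖ ^ 2) * ∑ j, ‖e j‖ ^ 2 := by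
  rw [Finset.sum_mul]
  refine Finset.sum_le_sum fun i _ => ?_
  have h : ‖D.mulVec e i‖ ≤ ∑ j, ‖D i j‖ * ‖e j‖ := by
    rw [Matrix.mulVec, dotProduct]
    exact (norm_sum_le _ _).trans (le_of_eq (Finset.sum_congr rfl fun j _ => norm_mul _ _))
  exact (pow_le_pow_left₀ (norm_nonneg _) h 2).trans (Finset.sum_mul_sq_le_sq_mul_sq _ _ _)

theorem energy_fromBlocks_inr_le (hw : ∀ z l z', 0 ≤ w z l z')
    (hw1 : ∀ z, ∑ z', ∑ l, w z l z' = 1) {ε K r : ℝ} (hε : 0 < ε)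
    (hK : ∀ k z l z' e, (1 + 1 / ε) * energy w A k z' ((D z l z').mulVec e) ≤
      K * r ^ k * ∑ j, ‖e j‖ ^ 2) (k : ℕ) (z : Z) (e : t → 𝕜) :
    energy w (fun z l z' => Matrix.fromBlocks (A z l z') (D z l z') 0 (E z l z')) k z
        (Sum.elim 0 e) ≤
      ∑ j ∈ Finset.range k, K * (1 + ε) ^ j * r ^ (k - 1 - j) * energy w E j z e +
        (1 + ε) ^ k * energy w E k z e := by
  induction k generalizing z e with
  | zero => simp [energy]
  | succ k ih =>
    have hstep : ∀ z' l,
        energy w (fun z l z' => Matrix.fromBlocks (A z l z') (D z l z') 0 (E z l z')) k z'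
          (Sum.elim ((D z l z').mulVec e) ((E z l z').mulVec e)) ≤
        K * r ^ k * ∑ j, ‖e j‖ ^ 2 + (1 + ε) *
          (∑ j ∈ Finset.range k, K * (1 + ε) ^ j * r ^ (k - 1 - j) *
            energy w E j z' ((E z l z').mulVec e) +
          (1 + ε) ^ k * energy w E k z' ((E z l z').mulVec e)) := by
      intro z' l
      have hsplit : (Sum.elim ((D z l z').mulVec e) ((E z l z').mulVec e) : s ⊕ t → 𝕜) =
          Sum.elim ((D z l z').mulVec e) 0 + Sum.elim (0 : s → 𝕜) ((E z l z').mulVec e) := by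
        ext (i | i) <;> simp
      rw [hsplit]
      refine (energy_add_le hw hε _ _ _ _).trans (add_le_add ?_ ?_)
      · rw [energy_fromBlocks_inl]
        exact hK _ _ _ _ _
      · exact mul_le_mul_of_nonneg_left (ih _ _) (by positivity)
    have hL : energy w (fun z l z' => Matrix.fromBlocks (A z l z') (D z l z') 0 (E z l z')) (k + 1)
        z (Sum.elim 0 e) = ∑ z', ∑ l, w z l z' *
          energy w (fun z l z' => Matrix.fromBlocks (A z l z') (D z l z') 0 (E z l z')) k z'
            (Sum.elim ((D z l z').mulVec e) ((E z l z').mulVec e)) := by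
      simp only [energy, fromBlocks_triangular_mulVec, Matrix.mulVec_zero, zero_add]
    rw [hL]
    refine (Finset.sum_le_sum fun z' _ => Finset.sum_le_sum fun l _ =>
      mul_le_mul_of_nonneg_left (hstep z' l) (hw _ _ _)).trans (le_of_eq ?_)
    have h1 : ∀ j, energy w E (j + 1) z e =
        ∑ z', ∑ l, w z l z' * energy w E j z' ((E z l z').mulVec e) := fun j => rfl
    have h0 : ∑ z', ∑ l, w z l z' * (K * r ^ k * ∑ j, ‖e j‖ ^ 2) =
        K * (1 + ε) ^ 0 * r ^ (k + 1 - 1 - 0) * energy w E 0 z e := by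
      simp only [← Finset.sum_mul, hw1, energy]
      simp
    rw [Finset.sum_range_succ', ← h0]
    simp only [mul_add, Finset.sum_add_distrib, h1, Finset.mul_sum]
    rw [add_comm (∑ j ∈ Finset.range k, _), add_assoc]
    congr 1
    congr 1
    · conv_rhs => rw [Finset.sum_comm]
      refine Finset.sum_congr rfl fun z' _ => ?_
      conv_rhs => rw [Finset.sum_comm]
      refine Finset.sum_congr rfl fun l _ => Finset.sum_congr rfl fun j hj => ?_
      have : k + 1 - 1 - (j + 1) = k - 1 - j := by omega
      rw [this]
      ring
    · refine Finset.sum_congr rfl fun z' _ => Finset.sum_congr rfl fun l _ => ?_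
      ring

/-- A block triangular jump linear system is stable iff its diagonal blocks are. -/
theorem energyStable_fromBlocks_iff (hw : ∀ z l z', 0 ≤ w z l z')
    (hw1 : ∀ z, ∑ z', ∑ l, w z l z' = 1) :
    EnergyStable w (fun z l z' => Matrix.fromBlocks (A z l z') (D z l z') 0 (E z l z')) ↔
      EnergyStable w A ∧ EnergyStable w E := by
  constructor
  · intro h
    refine ⟨fun z x => ?_, fun z e => ?_⟩
    · simpa only [energy_fromBlocks_inl] using h z (Sum.elim x 0)
    · exact squeeze_zero (fun k => energy_nonneg hw k z e)
        (fun k => energy_le_energy_fromBlocks hw k z 0 e) (h z (Sum.elim 0 e))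
  · rintro ⟨hA, hE⟩
    obtain ⟨C₁, r₁, hC₁, hr₁, hr₁', hb₁⟩ := hA.exists_le hw
    obtain ⟨C₂, r₂, hC₂, hr₂, hr₂', hb₂⟩ := hE.exists_le hw
    set r := max r₁ r₂ with hr
    have hr0 : 0 < r := lt_max_of_lt_left hr₁
    have hr1 : r < 1 := max_lt hr₁' hr₂'
    set ε := (1 - r) / (2 * r) with hεdef
    have hε : 0 < ε := div_pos (by linarith) (by linarith)
    have hq : (1 + ε) * r = (1 + r) / 2 := by
      rw [hεdef]; field_simp; ring
    set c := ∑ z, ∑ l, ∑ z', ∑ i, ∑ j, ‖D z l z' i j‖ ^ 2 with hc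
    have hDc : ∀ z l z', ∑ i, ∑ j, ‖D z l z' i j‖ ^ 2 ≤ c := by
      intro z l z'
      have hn : ∀ z l z', 0 ≤ ∑ i, ∑ j, ‖D z l z' i j‖ ^ 2 := fun z l z' =>
        Finset.sum_nonneg fun i _ => Finset.sum_nonneg fun j _ => by positivity
      calc ∑ i, ∑ j, ‖D z l z' i j‖ ^ 2 ≤ ∑ z', ∑ i, ∑ j, ‖D z l z' i j‖ ^ 2 :=
            Finset.single_le_sum (f := fun z' => ∑ i, ∑ j, ‖D z l z' i j‖ ^ 2)
              (fun z' _ => hn z l z') (Finset.mem_univ z')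
        _ ≤ ∑ l, ∑ z', ∑ i, ∑ j, ‖D z l z' i j‖ ^ 2 :=
            Finset.single_le_sum (f := fun l => ∑ z', ∑ i, ∑ j, ‖D z l z' i j‖ ^ 2)
              (fun l _ => Finset.sum_nonneg fun z' _ => hn z l z') (Finset.mem_univ l)
        _ ≤ c := Finset.single_le_sum (f := fun z => ∑ l, ∑ z', ∑ i, ∑ j, ‖D z l z' i j‖ ^ 2)
              (fun z _ => Finset.sum_nonneg fun l _ => Finset.sum_nonneg fun z' _ => hn z l z')
              (Finset.mem_univ z)
    have hc0 : 0 ≤ c := Finset.sum_nonneg fun z _ => Finset.sum_nonneg fun l _ =>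
      Finset.sum_nonneg fun z' _ => Finset.sum_nonneg fun i _ => Finset.sum_nonneg fun j _ => by
        positivity
    set K := (1 + 1 / ε) * (C₁ * c) with hKdef
    have hK0 : 0 ≤ K := by positivity
    have hK : ∀ k z l z' e, (1 + 1 / ε) * energy w A k z' ((D z l z').mulVec e) ≤
        K * r ^ k * ∑ j, ‖e j‖ ^ 2 := by
      intro k z l z' e
      have he : 0 ≤ ∑ j, ‖e j‖ ^ 2 := Finset.sum_nonneg fun j _ => by positivity
      have h1 : energy w A k z' ((D z l z').mulVec e) ≤ C₁ * r ^ k * (c * ∑ j, ‖e j‖ ^ 2) := by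
        refine (hb₁ _ _ _).trans ?_
        gcongr
        · exact le_max_left _ _
        · exact (sum_norm_mulVec_sq_le _ _).trans (mul_le_mul_of_nonneg_right (hDc _ _ _) he)
      calc _ ≤ (1 + 1 / ε) * (C₁ * r ^ k * (c * ∑ j, ‖e j‖ ^ 2)) :=
            mul_le_mul_of_nonneg_left h1 (by positivity)
        _ = _ := by rw [hKdef]; ring
    have hinr : ∀ z e, Tendsto (fun k => energy w
        (fun z l z' => Matrix.fromBlocks (A z l z') (D z l z') 0 (E z l z')) k z
          (Sum.elim 0 e)) atTop (𝓝 0) := by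
      intro z e
      rw [← tendsto_add_atTop_iff_nat 1]
      set q := (1 + ε) * r with hqdef
      set a := ∑ j, ‖e j‖ ^ 2 with ha
      have ha0 : 0 ≤ a := Finset.sum_nonneg fun j _ => by positivity
      have hq0 : 0 ≤ q := by positivity
      have hq1 : q < 1 := by rw [hq]; linarith
      have hEb : ∀ j, energy w E j z e ≤ C₂ * r ^ j * a := fun j => (hb₂ j z e).trans (by
        gcongr; exact le_max_right _ _)
      have hbound : ∀ k : ℕ, energy w
          (fun z l z' => Matrix.fromBlocks (A z l z') (D z l z') 0 (E z l z')) (k + 1) z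
            (Sum.elim 0 e) ≤ K * C₂ * a * (k * q ^ k + q ^ k) + C₂ * a * q * q ^ k := by
        intro k
        refine (energy_fromBlocks_inr_le hw hw1 hε hK (k + 1) z e).trans (add_le_add ?_ ?_)
        · calc _ ≤ ∑ j ∈ Finset.range (k + 1), K * C₂ * a * q ^ k := by
                refine Finset.sum_le_sum fun j hj => ?_
                have hj' : j ≤ k := Nat.lt_succ_iff.1 (Finset.mem_range.1 hj)
                have hsub : k + 1 - 1 - j + j = k := by omega
                calc _ ≤ K * (1 + ε) ^ j * r ^ (k + 1 - 1 - j) * (C₂ * r ^ j * a) :=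
                      mul_le_mul_of_nonneg_left (hEb j) (by positivity)
                  _ = K * C₂ * a * ((1 + ε) ^ j * r ^ (k + 1 - 1 - j + j)) := by
                      rw [pow_add]; ring
                  _ ≤ K * C₂ * a * ((1 + ε) ^ k * r ^ k) := by
                      rw [hsub]
                      gcongr
                      linarith
                  _ = _ := by rw [hqdef, mul_pow]
            _ = _ := by
                simp only [Finset.sum_const, Finset.card_range, nsmul_eq_mul]
                push_cast; ring
        · calc _ ≤ (1 + ε) ^ (k + 1) * (C₂ * r ^ (k + 1) * a) :=
                mul_le_mul_of_nonneg_left (hEb _) (by positivity)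
            _ = _ := by rw [hqdef, mul_pow]; ring
      refine squeeze_zero (fun k => energy_nonneg hw _ z _) hbound ?_
      have t1 := tendsto_pow_atTop_nhds_zero_of_lt_one hq0 hq1
      have t2 := tendsto_self_mul_const_pow_of_lt_one hq0 hq1
      simpa using ((t2.add t1).const_mul (K * C₂ * a)).add (t1.const_mul (C₂ * a * q))
    intro z v
    have hv : v = Sum.elim (v ∘ Sum.inl) 0 + Sum.elim (0 : s → 𝕜) (v ∘ Sum.inr) := by
      ext (i | i) <;> simp
    have t := ((hA z (v ∘ Sum.inl)).const_mul (1 + 1 / 1)).add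
      ((hinr z (v ∘ Sum.inr)).const_mul (1 + 1))
    simp only [mul_zero, add_zero] at t
    refine squeeze_zero (fun k => energy_nonneg hw _ z _) (fun k => ?_) t
    conv_lhs => rw [hv]
    refine (energy_add_le hw one_pos _ _ _ _).trans ?_
    rw [energy_fromBlocks_inl]

end Triangular

section Channels

variable {𝕜 : Type} [RCLike 𝕜] {nx nu ny nw N I : ℕ}

theorem MarkovChannel.packetProb_nonneg (ch : MarkovChannel N) (i : Fin N) (b : Bool) :
    0 ≤ ch.packetProb i b := by
  have h0 := ch.deliver_nonneg i
  have h1 := ch.deliver_le_one i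
  cases b <;> simp [packetProb, h0, h1]

theorem MarkovChannel.sum_packetProb (ch : MarkovChannel N) (i : Fin N) :
    ∑ b, ch.packetProb i b = 1 := by
  simp [packetProb]

/-- Probability of the transition `i → j` followed by the packet outcome `b`. -/
def MarkovChannel.step (ch : MarkovChannel N) (i : Fin N) (b : Bool) (j : Fin N) : ℝ :=
  ch.P i j * ch.packetProb j b

theorem MarkovChannel.step_nonneg (ch : MarkovChannel N) (i : Fin N) (b : Bool) (j : Fin N) :
    0 ≤ ch.step i b j :=
  mul_nonneg (ch.P_nonneg i j) (ch.packetProb_nonneg j b)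

theorem MarkovChannel.sum_step_packet (ch : MarkovChannel N) (i j : Fin N) :
    ∑ b, ch.step i b j = ch.P i j := by
  simp only [step, ← Finset.mul_sum, sum_packetProb, mul_one]

theorem MarkovChannel.sum_step (ch : MarkovChannel N) (i : Fin N) :
    ∑ j, ∑ b, ch.step i b j = 1 := by
  simp only [sum_step_packet, ch.P_sum]

/-- Transition probabilities of the pair of channels. -/
def jointStep (act : MarkovChannel N) (sen : MarkovChannel I) (z : Fin N × Fin I)
    (l : Bool × Bool) (z' : Fin N × Fin I) : ℝ :=
  act.step z.1 l.1 z'.1 * sen.step z.2 l.2 z'.2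

theorem jointStep_nonneg (act : MarkovChannel N) (sen : MarkovChannel I) (z : Fin N × Fin I)
    (l : Bool × Bool) (z' : Fin N × Fin I) : 0 ≤ jointStep act sen z l z' :=
  mul_nonneg (act.step_nonneg _ _ _) (sen.step_nonneg _ _ _)

theorem sum_jointStep_packet (act : MarkovChannel N) (sen : MarkovChannel I)
    (z z' : Fin N × Fin I) :
    ∑ l, jointStep act sen z l z' = act.P z.1 z'.1 * sen.P z.2 z'.2 := by
  simp only [jointStep, Fintype.sum_prod_type, ← Finset.mul_sum, ← Finset.sum_mul,
    MarkovChannel.sum_step_packet]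

theorem sum_jointStep (act : MarkovChannel N) (sen : MarkovChannel I) (z : Fin N × Fin I) :
    ∑ z', ∑ l, jointStep act sen z l z' = 1 := by
  simp only [sum_jointStep_packet]
  simp only [Fintype.sum_prod_type, ← Finset.mul_sum, MarkovChannel.P_sum, mul_one]

/-- The operational mode in a transition of the pair of channels. -/
def stepMode (z : Fin N × Fin I) (l : Bool × Bool) (z' : Fin N × Fin I) : Mode N I where
  ν := l.1
  θ := z'.1
  θprev := z.1
  γ := l.2
  η := z'.2

/-- Stability of `x_{k+1} = Γ(mode_k) x_k`. -/
def NoiselessStable {s : Type} [Fintype s] (act : MarkovChannel N) (sen : MarkovChannel I)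
    (Γ : Mode N I → Matrix s s 𝕜) : Prop :=
  EnergyStable (jointStep act sen) fun z l z' => Γ (stepMode z l z')

/-- Error dynamics do not see the actuation channel. -/
theorem energy_jointStep_sensing {s : Type} [Fintype s] (act : MarkovChannel N)
    (sen : MarkovChannel I) (Γ : Fin I → Bool → Fin I → Matrix s s 𝕜) (k : ℕ) (z : Fin N × Fin I)
    (v : s → 𝕜) :
    energy (jointStep act sen) (fun z l z' => Γ z.2 l.2 z'.2) k z v =
      energy sen.step Γ k z.2 v := by
  induction k generalizing z v with
  | zero => rfl
  | succ k ih =>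
    simp only [energy, ih, jointStep, Fintype.sum_prod_type]
    have h : ∀ (i : Fin N) (n : Fin I), ∑ b, ∑ c, act.step z.1 b i * sen.step z.2 c n *
        energy sen.step Γ k n ((Γ z.2 c n).mulVec v) =
        act.P z.1 i * ∑ c, sen.step z.2 c n * energy sen.step Γ k n ((Γ z.2 c n).mulVec v) := by
      intro i n
      rw [← MarkovChannel.sum_step_packet, Finset.sum_mul]
      refine Finset.sum_congr rfl fun b _ => ?_
      rw [Finset.mul_sum]
      exact Finset.sum_congr rfl fun c _ => mul_assoc _ _ _
    simp only [h, ← Finset.mul_sum, ← Finset.sum_mul, MarkovChannel.P_sum, one_mul]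

theorem secondMomentOp_eq_momentOp (sen : MarkovChannel I)
    (Γ1 Γ0 : Fin I → Matrix (Fin nx) (Fin nx) 𝕜) :
    secondMomentOp sen Γ1 Γ0 = momentOp sen.step fun _ c n => if c then Γ1 n else Γ0 n := by
  refine LinearMap.ext fun S => funext fun n => ?_
  simp only [secondMomentOp, momentOp, averageModes, LinearMap.coe_mk, AddHom.coe_mk,
    Fintype.sum_bool, MarkovChannel.step, MarkovChannel.packetProb, if_true, Bool.false_eq_true,
    if_false, Matrix.mul_sum, Matrix.sum_mul, Finset.smul_sum, ← Finset.sum_add_distrib,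
    Matrix.mul_smul, Matrix.smul_mul, smul_smul]
  refine Finset.sum_congr rfl fun m _ => ?_
  congr 2
  · push_cast; ring
  · push_cast; ring

theorem MarkovChannel.modes_nonempty (ch : MarkovChannel N) : Nonempty (Fin N) := by
  obtain ⟨π, hπ, -⟩ := ch.ergodic
  by_contra h
  rw [not_nonempty_iff] at h
  have := hπ.2
  simp at this

attribute [local instance] Matrix.normedAddCommGroup Matrix.normedSpace in
theorem operatorRadius_secondMomentOp_lt_one_iff (p : Plant 𝕜 nx nu ny nw)
    (act : MarkovChannel N) (sen : MarkovChannel I) (M : Fin I → Matrix (Fin nx) (Fin ny) 𝕜) :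
    operatorRadius (secondMomentOp sen (fun n => p.A + M n * p.L) (fun _ => p.A)) < 1 ↔
      NoiselessStable act sen (fun m => p.A + bit 𝕜 m.γ • (M m.η * p.L)) := by
  have h1 : (fun (_ : Fin I) (c : Bool) (n : Fin I) => if c then p.A + M n * p.L else p.A) =
      fun _ c n => p.A + bit 𝕜 c • (M n * p.L) := by
    funext _ c n
    cases c <;> simp [bit]
  rw [secondMomentOp_eq_momentOp, h1]
  refine (operatorRadius_lt_one_iff _).trans
    ((energyStable_iff_momentOp fun z l z' => sen.step_nonneg z l z').symm.trans ?_)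
  have h2 := energy_jointStep_sensing act sen (fun _ c n => p.A + bit 𝕜 c • (M n * p.L))
  constructor
  · intro h z v
    exact (h z.2 v).congr fun k => (h2 k z v).symm
  · intro h n v
    obtain ⟨i⟩ := act.modes_nonempty
    exact (h (i, n) v).congr fun k => h2 k (i, n) v

theorem noiselessStable_closedLoop_iff (p : Plant 𝕜 nx nu ny nw)
    (act : MarkovChannel N) (sen : MarkovChannel I) (F : Fin N → Matrix (Fin nu) (Fin nx) 𝕜)
    (M : Fin I → Matrix (Fin nx) (Fin ny) 𝕜) :
    NoiselessStable act sen (p.closedLoopΓ F M) ↔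
      NoiselessStable act sen (p.feedbackΓ F) ∧
        NoiselessStable act sen (fun m => p.A + bit 𝕜 m.γ • (M m.η * p.L)) :=
  energyStable_fromBlocks_iff (jointStep_nonneg act sen) (sum_jointStep act sen)

end Channels

section Paths

variable {N I : ℕ}

/-- Trajectories of the two channels: the actuation mode at time `-1`, the modes and packets of the
actuation channel, and those of the sensing channel. -/
abbrev ChannelPath (N I : ℕ) : Type :=
  (Fin N × (ℕ → Fin N × Bool)) × (ℕ → Fin I × Bool)

/-- What is seen of a channel trajectory before time `K`. -/
abbrev ChannelHistory (N I K : ℕ) : Type :=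
  (Fin N × (Fin K → Fin N × Bool)) × (Fin K → Fin I × Bool)

namespace ChannelPath

/-- Truncation of a channel trajectory at time `K`. -/
def history (K : ℕ) (τ : ChannelPath N I) : ChannelHistory N I K :=
  ((τ.1.1, fun t => τ.1.2 t), fun t => τ.2 t)

/-- The pair of channel modes at time `k`. -/
def modes (k : ℕ) (τ : ChannelPath N I) : Fin N × Fin I := ((τ.1.2 k).1, (τ.2 k).1)

/-- The pair of packet indicators at time `k`. -/
def packets (k : ℕ) (τ : ChannelPath N I) : Bool × Bool := ((τ.1.2 k).2, (τ.2 k).2)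

/-- The operational mode at time `k`. -/
def mode (k : ℕ) (τ : ChannelPath N I) : Mode N I where
  ν := (τ.1.2 k).2
  θ := (τ.1.2 k).1
  θprev := match k with
    | 0 => τ.1.1
    | k + 1 => (τ.1.2 k).1
  γ := (τ.2 k).2
  η := (τ.2 k).1

theorem measurable_history (K : ℕ) : Measurable (history K : ChannelPath N I → _) := by
  unfold history
  fun_prop

theorem history_eq_iff (K : ℕ) (σ τ : ChannelPath N I) :
    σ.history K = τ.history K ↔
      (σ.1.1 = τ.1.1 ∧ ∀ t < K, σ.1.2 t = τ.1.2 t) ∧ ∀ t < K, σ.2 t = τ.2 t := by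
  simp only [history, Prod.mk.injEq, funext_iff, Fin.forall_iff]

/-- `g` only depends on what is seen of the channels before time `K`. -/
def Past {β : Type} (K : ℕ) (g : ChannelPath N I → β) : Prop :=
  g.FactorsThrough (history K)

variable {β β' β'' : Type} {K : ℕ}

theorem Past.mono {K' : ℕ} (h : K ≤ K') {g : ChannelPath N I → β} (hg : Past K g) :
    Past K' g := by
  intro σ τ hστ
  rw [history_eq_iff] at hστ
  refine hg ((history_eq_iff _ _ _).2 ⟨⟨hστ.1.1, fun t ht => hστ.1.2 t (by omega)⟩,
    fun t ht => hστ.2 t (by omega)⟩)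

theorem Past.map (F : β → β') {g : ChannelPath N I → β} (hg : Past K g) :
    Past K fun τ => F (g τ) := fun _ _ h => congrArg F (hg h)

theorem Past.map₂ (F : β → β' → β'') {g : ChannelPath N I → β} {g' : ChannelPath N I → β'}
    (hg : Past K g) (hg' : Past K g') : Past K fun τ => F (g τ) (g' τ) :=
  fun _ _ h => congrArg₂ F (hg h) (hg' h)

theorem past_const (c : β) : Past K fun _ : ChannelPath N I => c := fun _ _ _ => rfl

theorem past_modes {k : ℕ} (hk : k < K) : Past K (modes k : ChannelPath N I → _) := by
  intro σ τ h
  rw [history_eq_iff] at h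
  simp only [modes, h.1.2 k hk, h.2 k hk]

theorem past_packets {k : ℕ} (hk : k < K) : Past K (packets k : ChannelPath N I → _) := by
  intro σ τ h
  rw [history_eq_iff] at h
  simp only [packets, h.1.2 k hk, h.2 k hk]

theorem past_mode {k : ℕ} (hk : k < K) : Past K (mode k : ChannelPath N I → _) := by
  intro σ τ h
  rw [history_eq_iff] at h
  cases k with
  | zero => simp only [mode, h.1.2 0 hk, h.2 0 hk, h.1.1]
  | succ k => simp only [mode, h.1.2 _ hk, h.2 _ hk, h.1.2 k (by omega)]

theorem Past.exists_eq_comp [Nonempty β] {g : ChannelPath N I → β} (hg : Past K g) :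
    ∃ e : ChannelHistory N I K → β, g = e ∘ history K :=
  (Function.factorsThrough_iff g).1 hg

theorem Past.measurable {g : ChannelPath N I → β} [MeasurableSpace β] (hg : Past K g) :
    Measurable g := by
  rcases isEmpty_or_nonempty β with h | h
  · have : IsEmpty (ChannelPath N I) := Function.isEmpty g
    exact measurable_of_empty g
  · obtain ⟨e, rfl⟩ := hg.exists_eq_comp
    exact (Measurable.of_discrete (f := e)).comp (measurable_history K)

theorem Past.exists_norm_le {𝕜 : Type} [RCLike 𝕜] {g : ChannelPath N I → 𝕜} (hg : Past K g) :
    ∃ C, ∀ τ, ‖g τ‖ ≤ C := by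
  obtain ⟨e, rfl⟩ := hg.exists_eq_comp
  obtain ⟨C, hC⟩ := (Set.finite_range fun h => ‖e h‖).bddAbove
  exact ⟨C, fun τ => hC ⟨_, rfl⟩⟩

end ChannelPath

end Paths

section PathLaw

variable {𝕜 : Type} [RCLike 𝕜] {N I nw : ℕ} {act : MarkovChannel N} {sen : MarkovChannel I}
  {W : Measure (ℕ → Fin nw → 𝕜)} {s : Type} [Fintype s] {Ω : Type} [MeasurableSpace Ω]
  {Pr : Measure Ω}

/-- The channel trajectories of a realization. -/
def Realization.path (R : Realization act sen W s Pr) (ω : Ω) : ChannelPath N I :=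
  ((R.θpast ω, fun k => (R.θ k ω, R.ν k ω)), fun k => (R.η k ω, R.γ k ω))

theorem Realization.mode_eq (R : Realization act sen W s Pr) (k : ℕ) (ω : Ω) :
    R.mode k ω = (R.path ω).mode k := by
  cases k <;> rfl

theorem Realization.measurable_actuation (R : Realization act sen W s Pr) :
    Measurable fun ω => (R.θpast ω, fun k => (R.θ k ω, R.ν k ω)) :=
  R.actuation.measurable_past.prodMk (measurable_pi_lambda _ fun k =>
    (R.actuation.measurable_mode k).prodMk (R.actuation.measurable_recv k))

theorem Realization.measurable_sensing (R : Realization act sen W s Pr) :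
    Measurable fun ω k => (R.η k ω, R.γ k ω) :=
  measurable_pi_lambda _ fun k =>
    (R.sensing.measurable_mode k).prodMk (R.sensing.measurable_recv k)

theorem Realization.measurable_path (R : Realization act sen W s Pr) : Measurable R.path :=
  R.measurable_actuation.prodMk R.measurable_sensing

theorem Realization.indepFun_channels (R : Realization act sen W s Pr) :
    IndepFun (fun ω => (R.θpast ω, fun k => (R.θ k ω, R.ν k ω))) (fun ω k => (R.η k ω, R.γ k ω))
      Pr :=
  R.indep_sen.comp (φ := Prod.snd) (ψ := id) measurable_snd measurable_id

/-- The probability of a history of both channels is the product of those of its parts. -/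
theorem Realization.prob_history (R : Realization act sen W s Pr) (K : ℕ) (τ : ChannelPath N I) :
    Pr.real {ω | (R.path ω).history K = τ.history K} =
      Pr.real {ω | R.θpast ω = τ.1.1 ∧ ∀ t < K, R.θ t ω = (τ.1.2 t).1 ∧ R.ν t ω = (τ.1.2 t).2} *
      Pr.real {ω | ∀ t < K, R.η t ω = (τ.2 t).1 ∧ R.γ t ω = (τ.2 t).2} := by
  set f : (Fin N × (ℕ → Fin N × Bool)) → Fin N × (Fin K → Fin N × Bool) :=
    fun a => (a.1, fun t => a.2 t)
  set g : (ℕ → Fin I × Bool) → (Fin K → Fin I × Bool) := fun a t => a t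
  have hf : Measurable f := by fun_prop
  have hg : Measurable g := by fun_prop
  have hind := R.indepFun_channels.comp hf hg
  have h := hind.measure_inter_preimage_eq_mul {f τ.1} {g τ.2} (measurableSet_singleton _)
    (measurableSet_singleton _)
  have e1 : {ω | R.θpast ω = τ.1.1 ∧ ∀ t < K, R.θ t ω = (τ.1.2 t).1 ∧ R.ν t ω = (τ.1.2 t).2} =
      (f ∘ fun ω => (R.θpast ω, fun k => (R.θ k ω, R.ν k ω))) ⁻¹' {f τ.1} := by
    ext ω
    simp only [f, Set.mem_ofPred_eq, Set.mem_preimage, Function.comp_apply, Set.mem_singleton_iff,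
      funext_iff, Fin.forall_iff, Prod.ext_iff]
  have e2 : {ω | ∀ t < K, R.η t ω = (τ.2 t).1 ∧ R.γ t ω = (τ.2 t).2} =
      (g ∘ fun ω k => (R.η k ω, R.γ k ω)) ⁻¹' {g τ.2} := by
    ext ω
    simp only [g, Set.mem_ofPred_eq, Set.mem_preimage, Function.comp_apply, Set.mem_singleton_iff,
      funext_iff, Fin.forall_iff, Prod.ext_iff]
  have e3 : {ω | (R.path ω).history K = τ.history K} =
      (f ∘ fun ω => (R.θpast ω, fun k => (R.θ k ω, R.ν k ω))) ⁻¹' {f τ.1} ∩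
      (g ∘ fun ω k => (R.η k ω, R.γ k ω)) ⁻¹' {g τ.2} := by
    rw [← e1, ← e2]
    ext ω
    simp only [Set.mem_ofPred_eq, Set.mem_inter_iff, ChannelPath.history_eq_iff]
    simp only [Realization.path, Prod.ext_iff]
  rw [e1, e2, e3, measureReal_def, h, ENNReal.toReal_mul, measureReal_def, measureReal_def]

theorem Realization.prob_history_succ (R : Realization act sen W s Pr) (k : ℕ)
    (τ : ChannelPath N I) :
    Pr.real {ω | (R.path ω).history (k + 2) = τ.history (k + 2)} =
      Pr.real {ω | (R.path ω).history (k + 1) = τ.history (k + 1)} *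
        jointStep act sen (τ.modes k) (τ.packets (k + 1)) (τ.modes (k + 1)) := by
  have h1 := R.actuation.path_succ k τ.1.1 (fun t => (τ.1.2 t).1) (fun t => (τ.1.2 t).2)
  have h2 := R.sensing.path_succ k () (fun t => (τ.2 t).1) (fun t => (τ.2 t).2)
  simp only [← Nat.lt_add_one_iff, true_and] at h1 h2
  rw [prob_history, prob_history]
  refine (congrArg₂ (· * ·) h1 h2).trans ?_
  simp only [jointStep, MarkovChannel.step, ChannelPath.modes, ChannelPath.packets]
  ring

variable [IsProbabilityMeasure Pr]

theorem Realization.integrable_past (R : Realization act sen W s Pr) {K : ℕ}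
    {g : ChannelPath N I → 𝕜} (hg : ChannelPath.Past K g) :
    Integrable (fun ω => g (R.path ω)) Pr := by
  obtain ⟨C, hC⟩ := hg.exists_norm_le
  exact Integrable.of_bound (hg.measurable.comp R.measurable_path).aestronglyMeasurable C
    (Eventually.of_forall fun ω => hC _)

/-- Expectations of functions of the history, term by term. -/
theorem Realization.integral_congr_history (R : Realization act sen W s Pr) {K K' : ℕ}
    {g g' : ChannelPath N I → 𝕜} (hg : ChannelPath.Past K' g) (hg' : ChannelPath.Past K' g')
    (h : ∀ τ : ChannelPath N I,
      ∫ ω in {ω | (R.path ω).history K = τ.history K}, g (R.path ω) ∂Pr =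
        ∫ ω in {ω | (R.path ω).history K = τ.history K}, g' (R.path ω) ∂Pr) :
    ∫ ω, g (R.path ω) ∂Pr = ∫ ω, g' (R.path ω) ∂Pr := by
  have hmeas : ∀ a : ChannelHistory N I K,
      MeasurableSet {ω | (R.path ω).history K = a} := fun a =>
    ((ChannelPath.measurable_history K).comp R.measurable_path) (measurableSet_singleton a)
  have hdecomp : ∀ f : Ω → 𝕜, Integrable f Pr → ∫ ω, f ω ∂Pr =
      ∑ a : ChannelHistory N I K, ∫ ω in {ω | (R.path ω).history K = a}, f ω ∂Pr := by
    intro f hf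
    rw [← integral_iUnion_fintype (fun a => hmeas a) (fun a b hab => by
        refine Set.disjoint_left.2 fun ω h1 h2 => hab ?_
        rw [← (show _ = a from h1), ← (show _ = b from h2)]) (fun a => hf.integrableOn)]
    have : (⋃ a : ChannelHistory N I K, {ω | (R.path ω).history K = a}) = Set.univ := by
      ext ω
      simp
    rw [this, Measure.restrict_univ]
  rw [hdecomp _ (R.integrable_past hg), hdecomp _ (R.integrable_past hg')]
  refine Finset.sum_congr rfl fun a _ => ?_
  by_cases ha : ∃ τ : ChannelPath N I, τ.history K = a
  · obtain ⟨τ, rfl⟩ := ha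
    exact h τ
  · have : {ω | (R.path ω).history K = a} = ∅ := by
      ext ω
      simp only [Set.mem_ofPred_eq, Set.mem_empty_iff_false, iff_false]
      exact fun h => ha ⟨_, h⟩
    rw [this]
    simp

/-- The Markov property of the pair of channels. -/
theorem Realization.markov (R : Realization act sen W s Pr) (k : ℕ) {φ : ChannelPath N I → 𝕜}
    (hφ : ChannelPath.Past (k + 1) φ) (z' : Fin N × Fin I) (l : Bool × Bool) :
    ∫ ω, φ (R.path ω) * (if (R.path ω).modes (k + 1) = z' ∧ (R.path ω).packets (k + 1) = l
        then 1 else 0) ∂Pr =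
      ∫ ω, φ (R.path ω) * (jointStep act sen ((R.path ω).modes k) l z' : 𝕜) ∂Pr := by
  have hφ' := hφ.mono (Nat.le_succ (k + 1))
  refine R.integral_congr_history (K := k + 1) (K' := k + 2)
    (g := fun τ => φ τ * (if τ.modes (k + 1) = z' ∧ τ.packets (k + 1) = l then 1 else 0))
    (g' := fun τ => φ τ * (jointStep act sen (τ.modes k) l z' : 𝕜))
    (hφ'.map₂ (· * ·) ((ChannelPath.past_modes (Nat.lt_succ_self _)).map₂
      (fun a b => if a = z' ∧ b = l then (1 : 𝕜) else 0)
      (ChannelPath.past_packets (Nat.lt_succ_self _))))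
    (hφ'.map₂ (· * ·) ((ChannelPath.past_modes (by omega)).map
      fun a => (jointStep act sen a l z' : 𝕜))) fun τ => ?_
  have hmeas : ∀ (K : ℕ) (a : ChannelHistory N I K),
      MeasurableSet {ω | (R.path ω).history K = a} := fun K a =>
    ((ChannelPath.measurable_history K).comp R.measurable_path) (measurableSet_singleton a)
  let τ' : ChannelPath N I := ((τ.1.1, fun t => if t = k + 1 then (z'.1, l.1) else τ.1.2 t),
    fun t => if t = k + 1 then (z'.2, l.2) else τ.2 t)
  have hτ' : τ'.history (k + 1) = τ.history (k + 1) := by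
    rw [ChannelPath.history_eq_iff]
    refine ⟨⟨rfl, fun t ht => if_neg (by omega)⟩, fun t ht => if_neg (by omega)⟩
  have hmodes : τ'.modes k = τ.modes k := ChannelPath.past_modes (Nat.lt_succ_self k) hτ'
  have hmodes' : τ'.modes (k + 1) = z' := by simp [τ', ChannelPath.modes]
  have hpackets' : τ'.packets (k + 1) = l := by simp [τ', ChannelPath.packets]
  have hset : ∀ ω, ((R.path ω).history (k + 1) = τ.history (k + 1) ∧
      (R.path ω).modes (k + 1) = z' ∧ (R.path ω).packets (k + 1) = l) ↔
      (R.path ω).history (k + 2) = τ'.history (k + 2) := by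
    intro ω
    rw [← hτ']
    constructor
    · rintro ⟨h1, h2, h3⟩
      rw [ChannelPath.history_eq_iff] at h1 ⊢
      have e1 : (R.path ω).1.2 (k + 1) = τ'.1.2 (k + 1) := by
        have a := congrArg Prod.fst (h2.trans hmodes'.symm)
        have b := congrArg Prod.fst (h3.trans hpackets'.symm)
        exact Prod.ext a b
      have e2 : (R.path ω).2 (k + 1) = τ'.2 (k + 1) := by
        have a := congrArg Prod.snd (h2.trans hmodes'.symm)
        have b := congrArg Prod.snd (h3.trans hpackets'.symm)
        exact Prod.ext a b
      refine ⟨⟨h1.1.1, fun t ht => ?_⟩, fun t ht => ?_⟩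
      · rcases Nat.lt_succ_iff_lt_or_eq.1 ht with h | rfl
        · exact h1.1.2 t h
        · exact e1
      · rcases Nat.lt_succ_iff_lt_or_eq.1 ht with h | rfl
        · exact h1.2 t h
        · exact e2
    · intro h
      refine ⟨?_, ?_, ?_⟩
      · rw [ChannelPath.history_eq_iff] at h ⊢
        exact ⟨⟨h.1.1, fun t ht => h.1.2 t (by omega)⟩, fun t ht => h.2 t (by omega)⟩
      · exact (ChannelPath.past_modes (Nat.lt_succ_self _) h).trans hmodes'
      · exact (ChannelPath.past_packets (Nat.lt_succ_self _) h).trans hpackets'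
  have hl : ∫ ω in {ω | (R.path ω).history (k + 1) = τ.history (k + 1)}, φ (R.path ω) *
      (if (R.path ω).modes (k + 1) = z' ∧ (R.path ω).packets (k + 1) = l then 1 else 0) ∂Pr =
      ∫ ω, ({ω | (R.path ω).history (k + 2) = τ'.history (k + 2)}).indicator
        (fun _ => φ τ) ω ∂Pr := by
    rw [← integral_indicator (hmeas _ _)]
    refine integral_congr_ae (Eventually.of_forall fun ω => ?_)
    simp only [Set.indicator_apply, Set.mem_ofPred_eq, ← hset]
    by_cases h : (R.path ω).history (k + 1) = τ.history (k + 1)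
    · rw [if_pos h, hφ h]
      by_cases h' : (R.path ω).modes (k + 1) = z' ∧ (R.path ω).packets (k + 1) = l
      · rw [if_pos h', if_pos ⟨h, h'⟩, mul_one]
      · rw [if_neg h', if_neg fun hh => h' hh.2, mul_zero]
    · rw [if_neg h, if_neg fun hh => h hh.1]
  have hr : ∫ ω in {ω | (R.path ω).history (k + 1) = τ.history (k + 1)}, φ (R.path ω) *
      (jointStep act sen ((R.path ω).modes k) l z' : 𝕜) ∂Pr =
      ∫ ω in {ω | (R.path ω).history (k + 1) = τ.history (k + 1)}, φ τ *
        (jointStep act sen (τ.modes k) l z' : 𝕜) ∂Pr := by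
    refine setIntegral_congr_fun (hmeas _ _) fun ω hω => ?_
    rw [hφ hω, ChannelPath.past_modes (Nat.lt_succ_self k) hω]
  rw [hl, hr, integral_indicator_const _ (hmeas _ _), setIntegral_const, R.prob_history_succ,
    hmodes, hmodes', hpackets', hτ', RCLike.real_smul_eq_coe_mul, RCLike.real_smul_eq_coe_mul]
  push_cast
  ring

end PathLaw

section Moments

variable {𝕜 : Type} [RCLike 𝕜] {N I nw : ℕ} {act : MarkovChannel N} {sen : MarkovChannel I}
  {W : Measure (ℕ → Fin nw → 𝕜)} {s : Type} [Fintype s] {Ω : Type} [MeasurableSpace Ω]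
  {Pr : Measure Ω}

/-- Conditional covariance of the state, given the channels. -/
def pathCov (Γ : Mode N I → Matrix s s 𝕜) (S : Mode N I → Matrix s (Fin nw) 𝕜)
    (C : Matrix s s 𝕜) : ℕ → ChannelPath N I → Matrix s s 𝕜
  | 0, _ => C
  | k + 1, τ => Γ (τ.mode k) * pathCov Γ S C k τ * (Γ (τ.mode k)).conjTranspose +
      S (τ.mode k) * (S (τ.mode k)).conjTranspose

/-- Conditional mean of the state, given the channels. -/
def pathMean (Γ : Mode N I → Matrix s s 𝕜) (m : s → 𝕜) : ℕ → ChannelPath N I → s → 𝕜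
  | 0, _ => m
  | k + 1, τ => (Γ (τ.mode k)).mulVec (pathMean Γ m k τ)

theorem past_pathCov (Γ : Mode N I → Matrix s s 𝕜) (S : Mode N I → Matrix s (Fin nw) 𝕜)
    (C : Matrix s s 𝕜) (k : ℕ) : ChannelPath.Past k (pathCov Γ S C k) := by
  induction k with
  | zero => exact ChannelPath.past_const C
  | succ k ih =>
    exact (ih.mono (Nat.le_succ k)).map₂ (fun X m => Γ m * X * (Γ m).conjTranspose +
      S m * (S m).conjTranspose) (ChannelPath.past_mode (Nat.lt_succ_self k))

theorem past_pathMean (Γ : Mode N I → Matrix s s 𝕜) (m : s → 𝕜) (k : ℕ) :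
    ChannelPath.Past k (pathMean Γ m k) := by
  induction k with
  | zero => exact ChannelPath.past_const m
  | succ k ih =>
    exact (ih.mono (Nat.le_succ k)).map₂ (fun x m => (Γ m).mulVec x)
      (ChannelPath.past_mode (Nat.lt_succ_self k))

/-- Without noise and from a deterministic state, the covariance is that of the mean. -/
theorem pathCov_outer (Γ : Mode N I → Matrix s s 𝕜) (m : s → 𝕜) (k : ℕ) (τ : ChannelPath N I) :
    pathCov Γ (fun _ => (0 : Matrix s (Fin nw) 𝕜)) (outer m m) k τ =
      outer (pathMean Γ m k τ) (pathMean Γ m k τ) := by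
  induction k with
  | zero => rfl
  | succ k ih =>
    simp only [pathCov, pathMean, ih, mul_outer_mul, Matrix.zero_mul, add_zero]

namespace Realization

theorem indepFun_x0_path [IsProbabilityMeasure Pr] (R : Realization act sen W s Pr) :
    IndepFun R.x0 R.path Pr := by
  have hx := R.measurable_x0.aemeasurable (μ := Pr)
  have ha := R.measurable_actuation.aemeasurable (μ := Pr)
  have hs := R.measurable_sensing.aemeasurable (μ := Pr)
  set a : Ω → Fin N × (ℕ → Fin N × Bool) := fun ω => (R.θpast ω, fun k => (R.θ k ω, R.ν k ω))
  set b : Ω → ℕ → Fin I × Bool := fun ω k => (R.η k ω, R.γ k ω)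
  have h1 := (indepFun_iff_map_prod_eq_prod_map_map hx ha).1 R.indep_act
  have h2 := (indepFun_iff_map_prod_eq_prod_map_map (hx.prodMk ha) hs).1
    (R.indep_sen.comp (φ := fun q => (q.1, q.2)) (ψ := id) (by fun_prop) measurable_id)
  have h3 := (indepFun_iff_map_prod_eq_prod_map_map ha hs).1 R.indepFun_channels
  have i1 := Measure.isProbabilityMeasure_map hx
  have i2 := Measure.isProbabilityMeasure_map ha
  have i3 := Measure.isProbabilityMeasure_map hs
  refine (indepFun_iff_map_prod_eq_prod_map_map hx (ha.prodMk hs)).2 ?_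
  rw [h3, ← Measure.prodAssoc_prod, ← h1, ← h2,
    AEMeasurable.map_map_of_aemeasurable (MeasurableEquiv.measurable _).aemeasurable
      ((hx.prodMk ha).prodMk hs)]
  rfl

theorem indepFun_x0_path_w (R : Realization act sen W s Pr) :
    IndepFun (fun ω => (R.x0 ω, R.path ω)) (fun ω k => R.w k ω) Pr :=
  R.indep_w

theorem measurable_noise (R : Realization act sen W s Pr) : Measurable fun ω k => R.w k ω :=
  measurable_pi_lambda _ R.measurable_w

theorem memLp_w (hW : IsWhiteNoise W) (R : Realization act sen W s Pr) (k : ℕ) (i : Fin nw) :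
    MemLp (fun ω => R.w k ω i) 2 Pr := by
  have h := hW.memLp k i
  rw [← R.law_w] at h
  exact h.comp_of_map R.measurable_noise.aemeasurable

theorem integral_noise (R : Realization act sen W s Pr) {f : (ℕ → Fin nw → 𝕜) → 𝕜}
    (hf : Measurable f) : ∫ ω, f (fun k => R.w k ω) ∂Pr = ∫ w, f w ∂W := by
  have h := integral_map (μ := Pr) R.measurable_noise.aemeasurable
    (hf.aestronglyMeasurable (μ := Pr.map fun ω k => R.w k ω))
  rw [R.law_w] at h
  exact h.symm

theorem memLp_x0_apply (R : Realization act sen W s Pr) (i : s) :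
    MemLp (fun ω => R.x0 ω i) 2 Pr :=
  R.memLp_x0.of_le ((measurable_pi_apply i).comp R.measurable_x0).aestronglyMeasurable
    (Eventually.of_forall fun ω => norm_le_pi_norm (R.x0 ω) i)

/-- State and noise at time `k`. -/
def extendedState (R : Realization act sen W s Pr) (Γ : Mode N I → Matrix s s 𝕜)
    (S : Mode N I → Matrix s (Fin nw) 𝕜) (k : ℕ) (ω : Ω) : s ⊕ Fin nw → 𝕜 :=
  Sum.elim (R.state Γ S k ω) (R.w k ω)

theorem state_succ (R : Realization act sen W s Pr) (Γ : Mode N I → Matrix s s 𝕜)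
    (S : Mode N I → Matrix s (Fin nw) 𝕜) (k : ℕ) (ω : Ω) (i : s) :
    R.state Γ S (k + 1) ω i = ∑ a, Matrix.fromCols (Γ ((R.path ω).mode k))
      (S ((R.path ω).mode k)) i a * R.extendedState Γ S k ω a := by
  simp only [state, R.mode_eq, Fintype.sum_sum_type, Matrix.fromCols_apply_inl,
    Matrix.fromCols_apply_inr, extendedState, Sum.elim_inl, Sum.elim_inr]
  rfl

theorem memLp_mul_past (R : Realization act sen W s Pr) {K : ℕ} {g : ChannelPath N I → 𝕜}
    (hg : ChannelPath.Past K g) {f : Ω → 𝕜} (hf : MemLp f 2 Pr) :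
    MemLp (fun ω => g (R.path ω) * f ω) 2 Pr := by
  obtain ⟨C, hC⟩ := hg.exists_norm_le
  refine hf.of_le_mul (c := C)
    ((hg.measurable.comp R.measurable_path).aestronglyMeasurable.mul hf.aestronglyMeasurable)
    (Eventually.of_forall fun ω => ?_)
  rw [norm_mul]
  exact mul_le_mul_of_nonneg_right (hC _) (norm_nonneg _)

theorem integrable_mul_past (R : Realization act sen W s Pr) {K : ℕ} {g : ChannelPath N I → 𝕜}
    (hg : ChannelPath.Past K g) {f f' : Ω → 𝕜} (hf : MemLp f 2 Pr) (hf' : MemLp f' 2 Pr) :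
    Integrable (fun ω => g (R.path ω) * (f ω * star (f' ω))) Pr := by
  have h : MemLp (fun ω => star (f' ω)) 2 Pr := hf'.star
  have := (R.memLp_mul_past hg hf).integrable_mul h
  refine this.congr (Eventually.of_forall fun ω => ?_)
  simp only [Pi.mul_apply, mul_assoc]

theorem memLp_state (hW : IsWhiteNoise W) (R : Realization act sen W s Pr)
    (Γ : Mode N I → Matrix s s 𝕜) (S : Mode N I → Matrix s (Fin nw) 𝕜) (k : ℕ) (i : s) :
    MemLp (fun ω => R.state Γ S k ω i) 2 Pr := by
  induction k generalizing i with
  | zero => exact R.memLp_x0_apply i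
  | succ k ih =>
    simp only [R.state_succ]
    refine memLp_finsetSum _ fun a _ => ?_
    refine R.memLp_mul_past (K := k + 1)
      (g := fun τ => Matrix.fromCols (Γ (τ.mode k)) (S (τ.mode k)) i a)
      ((ChannelPath.past_mode (Nat.lt_succ_self k)).map
        fun m => Matrix.fromCols (Γ m) (S m) i a) ?_
    rcases a with a | a
    · exact ih a
    · exact R.memLp_w hW k a

theorem memLp_extendedState (hW : IsWhiteNoise W) (R : Realization act sen W s Pr)
    (Γ : Mode N I → Matrix s s 𝕜) (S : Mode N I → Matrix s (Fin nw) 𝕜) (k : ℕ)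
    (a : s ⊕ Fin nw) : MemLp (fun ω => R.extendedState Γ S k ω a) 2 Pr := by
  rcases a with a | a
  · exact R.memLp_state hW Γ S k a
  · exact R.memLp_w hW k a

theorem integral_past_noise (hW : IsWhiteNoise W) (R : Realization act sen W s Pr) {K : ℕ}
    {g : ChannelPath N I → 𝕜} (hg : ChannelPath.Past K g) (l : ℕ) (j : Fin nw) :
    ∫ ω, g (R.path ω) * R.w l ω j ∂Pr = 0 := by
  have hm : Measurable fun q : (s → 𝕜) × ChannelPath N I => g q.2 :=
    hg.measurable.comp measurable_snd
  have hm' : Measurable fun w : ℕ → Fin nw → 𝕜 => w l j := by fun_prop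
  have h := R.indepFun_x0_path_w.integral_fun_comp_mul_comp (f := fun q => g q.2)
    (g := fun w : ℕ → Fin nw → 𝕜 => w l j)
    (R.measurable_x0.prodMk R.measurable_path).aemeasurable R.measurable_noise.aemeasurable
    hm.aestronglyMeasurable hm'.aestronglyMeasurable
  rw [h, R.integral_noise hm', hW.mean, mul_zero]

theorem integral_past_x0_noise (hW : IsWhiteNoise W) (R : Realization act sen W s Pr) {K : ℕ}
    {g : ChannelPath N I → 𝕜} (hg : ChannelPath.Past K g) (i : s) (l : ℕ) (j : Fin nw) :
    ∫ ω, g (R.path ω) * (R.x0 ω i * star (R.w l ω j)) ∂Pr = 0 := by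
  have hm : Measurable fun q : (s → 𝕜) × ChannelPath N I => g q.2 * q.1 i :=
    (hg.measurable.comp measurable_snd).mul ((measurable_pi_apply i).comp measurable_fst)
  have hm' : Measurable fun w : ℕ → Fin nw → 𝕜 => star (w l j) :=
    continuous_star.measurable.comp (by fun_prop)
  have h := R.indepFun_x0_path_w.integral_fun_comp_mul_comp (f := fun q => g q.2 * q.1 i)
    (g := fun w : ℕ → Fin nw → 𝕜 => star (w l j))
    (R.measurable_x0.prodMk R.measurable_path).aemeasurable R.measurable_noise.aemeasurable
    hm.aestronglyMeasurable hm'.aestronglyMeasurable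
  simp only [← mul_assoc]
  have h0 : ∫ w, star (w l j) ∂W = 0 := by
    have := integral_conj (μ := W) (f := fun w : ℕ → Fin nw → 𝕜 => w l j)
    simp only [hW.mean, map_zero] at this
    exact this
  rw [h, R.integral_noise hm', h0, mul_zero]

theorem integral_past_noise_noise (hW : IsWhiteNoise W) (R : Realization act sen W s Pr) {K : ℕ}
    {g : ChannelPath N I → 𝕜} (hg : ChannelPath.Past K g) (k l : ℕ) (i j : Fin nw) :
    ∫ ω, g (R.path ω) * (R.w k ω i * star (R.w l ω j)) ∂Pr =
      (∫ ω, g (R.path ω) ∂Pr) * if k = l ∧ i = j then 1 else 0 := by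
  have hm : Measurable fun q : (s → 𝕜) × ChannelPath N I => g q.2 :=
    hg.measurable.comp measurable_snd
  have hm' : Measurable fun w : ℕ → Fin nw → 𝕜 => w k i * star (w l j) :=
    Measurable.mul (by fun_prop) (continuous_star.measurable.comp (by fun_prop))
  have h := R.indepFun_x0_path_w.integral_fun_comp_mul_comp (f := fun q => g q.2)
    (g := fun w : ℕ → Fin nw → 𝕜 => w k i * star (w l j))
    (R.measurable_x0.prodMk R.measurable_path).aemeasurable R.measurable_noise.aemeasurable
    hm.aestronglyMeasurable hm'.aestronglyMeasurable
  rw [h, R.integral_noise hm', hW.covariance]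

/-- The state is uncorrelated with present and future noise, also given the channels. -/
theorem integral_past_state_noise (hW : IsWhiteNoise W) (R : Realization act sen W s Pr)
    (Γ : Mode N I → Matrix s s 𝕜) (S : Mode N I → Matrix s (Fin nw) 𝕜) {K k : ℕ} (hk : k ≤ K)
    {g : ChannelPath N I → 𝕜} (hg : ChannelPath.Past K g) (i : s) {l : ℕ} (hl : k ≤ l)
    (j : Fin nw) :
    ∫ ω, g (R.path ω) * (R.state Γ S k ω i * star (R.w l ω j)) ∂Pr = 0 := by
  induction k generalizing g i with
  | zero => exact R.integral_past_x0_noise hW hg i l j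
  | succ k ih =>
    have hg' : ∀ a, ChannelPath.Past K fun τ =>
        g τ * Matrix.fromCols (Γ (τ.mode k)) (S (τ.mode k)) i a := fun a =>
      hg.map₂ (fun x m => x * Matrix.fromCols (Γ m) (S m) i a) (ChannelPath.past_mode (by omega))
    have hexp : ∀ ω, g (R.path ω) * (R.state Γ S (k + 1) ω i * star (R.w l ω j)) =
        ∑ a, g (R.path ω) * Matrix.fromCols (Γ ((R.path ω).mode k)) (S ((R.path ω).mode k)) i a *
          (R.extendedState Γ S k ω a * star (R.w l ω j)) := by
      intro ω
      rw [R.state_succ, Finset.sum_mul, Finset.mul_sum]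
      exact Finset.sum_congr rfl fun a _ => by ring
    simp only [hexp]
    rw [integral_finsetSum _ fun a _ => R.integrable_mul_past (hg' a)
      (R.memLp_extendedState hW Γ S k a) (R.memLp_w hW l j)]
    refine Finset.sum_eq_zero fun a _ => ?_
    rcases a with a | a
    · exact ih (by omega) (hg' (Sum.inl a)) a (by omega)
    · have := R.integral_past_noise_noise hW (hg' (Sum.inr a)) k l a j
      rw [if_neg (by omega), mul_zero] at this
      exact this

variable [IsProbabilityMeasure Pr]

theorem integral_past_x0 (R : Realization act sen W s Pr) {K : ℕ}
    {g : ChannelPath N I → 𝕜} (hg : ChannelPath.Past K g) {f : (s → 𝕜) → 𝕜} (hf : Measurable f) :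
    ∫ ω, g (R.path ω) * f (R.x0 ω) ∂Pr = (∫ ω, g (R.path ω) ∂Pr) * ∫ ω, f (R.x0 ω) ∂Pr :=
  R.indepFun_x0_path.symm.integral_fun_comp_mul_comp R.measurable_path.aemeasurable
    R.measurable_x0.aemeasurable hg.measurable.aestronglyMeasurable hf.aestronglyMeasurable

/-- Second moments of the state, jointly with the channels. -/
theorem integral_past_state_state (hW : IsWhiteNoise W) (R : Realization act sen W s Pr)
    (Γ : Mode N I → Matrix s s 𝕜) (S : Mode N I → Matrix s (Fin nw) 𝕜) {K k : ℕ} (hk : k ≤ K)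
    {g : ChannelPath N I → 𝕜} (hg : ChannelPath.Past K g) (i j : s) :
    ∫ ω, g (R.path ω) * (R.state Γ S k ω i * star (R.state Γ S k ω j)) ∂Pr =
      ∫ ω, g (R.path ω) * pathCov Γ S
        (Matrix.of fun i j => ∫ ω, R.x0 ω i * star (R.x0 ω j) ∂Pr) k (R.path ω) i j ∂Pr := by
  induction k generalizing g i j with
  | zero =>
    have hm : Measurable fun x : s → 𝕜 => x i * star (x j) :=
      Measurable.mul (by fun_prop) (continuous_star.measurable.comp (by fun_prop))
    have := R.integral_past_x0 hg hm
    simp only [pathCov, Matrix.of_apply, integral_mul_const]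
    exact this
  | succ k ih =>
    set C := Matrix.of fun i j => ∫ ω, R.x0 ω i * star (R.x0 ω j) ∂Pr with hC
    set Θ : Mode N I → Matrix s (s ⊕ Fin nw) 𝕜 := fun m => Matrix.fromCols (Γ m) (S m) with hΘ
    set D : ChannelPath N I → Matrix (s ⊕ Fin nw) (s ⊕ Fin nw) 𝕜 := fun τ =>
      Matrix.fromBlocks (pathCov Γ S C k τ) 0 0 1 with hD
    have hDpast : ∀ a b, ChannelPath.Past K fun τ => D τ a b := fun a b =>
      ((past_pathCov Γ S C k).mono (by omega)).map fun X => Matrix.fromBlocks X 0 0 1 a b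
    have hg' : ∀ a b, ChannelPath.Past K fun τ =>
        g τ * (Θ (τ.mode k) i a * star (Θ (τ.mode k) j b)) := fun a b =>
      hg.map₂ (fun x m => x * (Θ m i a * star (Θ m j b))) (ChannelPath.past_mode (by omega))
    have hexp : ∀ ω, g (R.path ω) * (R.state Γ S (k + 1) ω i * star (R.state Γ S (k + 1) ω j)) =
        ∑ a, ∑ b, g (R.path ω) * (Θ ((R.path ω).mode k) i a * star (Θ ((R.path ω).mode k) j b)) *
          (R.extendedState Γ S k ω a * star (R.extendedState Γ S k ω b)) := by
      intro ω
      rw [R.state_succ, R.state_succ, star_sum, Finset.sum_mul_sum, Finset.mul_sum]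
      refine Finset.sum_congr rfl fun a _ => ?_
      rw [Finset.mul_sum]
      refine Finset.sum_congr rfl fun b _ => ?_
      rw [star_mul']
      ring
    have hcov : ∀ τ, g τ * pathCov Γ S C (k + 1) τ i j =
        ∑ a, ∑ b, g τ * (Θ (τ.mode k) i a * star (Θ (τ.mode k) j b)) * D τ a b := by
      intro τ
      have h1 : pathCov Γ S C (k + 1) τ =
          Θ (τ.mode k) * D τ * (Θ (τ.mode k)).conjTranspose := by
        simp only [hΘ, hD, pathCov, Matrix.conjTranspose_fromCols_eq_fromRows_conjTranspose,
          Matrix.fromCols_mul_fromBlocks, Matrix.fromCols_mul_fromRows, Matrix.mul_zero,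
          Matrix.mul_one, add_zero, zero_add]
      rw [h1, Matrix.mul_apply, Finset.mul_sum, Finset.sum_comm]
      refine Finset.sum_congr rfl fun b _ => ?_
      rw [Matrix.mul_apply, Finset.sum_mul, Finset.mul_sum]
      refine Finset.sum_congr rfl fun a _ => ?_
      rw [Matrix.conjTranspose_apply]
      ring
    have hterm : ∀ a b, ∫ ω, g (R.path ω) *
        (Θ ((R.path ω).mode k) i a * star (Θ ((R.path ω).mode k) j b)) *
          (R.extendedState Γ S k ω a * star (R.extendedState Γ S k ω b)) ∂Pr =
        ∫ ω, g (R.path ω) *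
          (Θ ((R.path ω).mode k) i a * star (Θ ((R.path ω).mode k) j b)) * D (R.path ω) a b ∂Pr := by
      intro a b
      rcases a with a | a <;> rcases b with b | b
      · exact ih (by omega) (hg' (Sum.inl a) (Sum.inl b)) a b
      · have := R.integral_past_state_noise hW Γ S (by omega : k ≤ K)
          (hg' (Sum.inl a) (Sum.inr b)) a le_rfl b
        simp only [hD, Matrix.fromBlocks_apply₁₂, Matrix.zero_apply, mul_zero, integral_zero]
        exact this
      · have hs : ChannelPath.Past K fun τ =>
            star (g τ * (Θ (τ.mode k) i (Sum.inr a) * star (Θ (τ.mode k) j (Sum.inl b)))) :=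
          (hg' (Sum.inr a) (Sum.inl b)).map star
        have h1 := R.integral_past_state_noise hW Γ S (by omega : k ≤ K) hs b le_rfl a
        have h2 := integral_conj (μ := Pr) (f := fun ω => star (g (R.path ω) *
          (Θ ((R.path ω).mode k) i (Sum.inr a) * star (Θ ((R.path ω).mode k) j (Sum.inl b)))) *
          (R.state Γ S k ω b * star (R.w k ω a)))
        simp only [hD, Matrix.fromBlocks_apply₂₁, Matrix.zero_apply, mul_zero, integral_zero]
        rw [h1, map_zero] at h2
        rw [← h2]
        refine integral_congr_ae (Eventually.of_forall fun ω => ?_)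
        simp only [extendedState, Sum.elim_inl, Sum.elim_inr, starRingEnd_apply, star_mul',
          star_star]
        ring
      · have := R.integral_past_noise_noise hW (hg' (Sum.inr a) (Sum.inr b)) k k a b
        simp only [true_and] at this
        simp only [hD, Matrix.fromBlocks_apply₂₂, Matrix.one_apply, integral_mul_const]
        exact this
    simp only [hexp, hcov]
    have hint : ∀ a b, Integrable (fun ω => g (R.path ω) *
        (Θ ((R.path ω).mode k) i a * star (Θ ((R.path ω).mode k) j b)) *
          (R.extendedState Γ S k ω a * star (R.extendedState Γ S k ω b))) Pr := fun a b =>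
      R.integrable_mul_past (hg' a b) (R.memLp_extendedState hW Γ S k a)
        (R.memLp_extendedState hW Γ S k b)
    have hint' : ∀ a b, Integrable (fun ω => g (R.path ω) *
        (Θ ((R.path ω).mode k) i a * star (Θ ((R.path ω).mode k) j b)) * D (R.path ω) a b) Pr :=
      fun a b => R.integrable_past ((hg' a b).map₂ (· * ·) (hDpast a b))
    rw [integral_finsetSum _ fun a _ => integrable_finsetSum _ fun b _ => hint a b,
      integral_finsetSum _ fun a _ => integrable_finsetSum _ fun b _ => hint' a b]
    refine Finset.sum_congr rfl fun a _ => ?_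
    rw [integral_finsetSum _ fun b _ => hint a b, integral_finsetSum _ fun b _ => hint' a b]
    exact Finset.sum_congr rfl fun b _ => hterm a b

/-- First moments of the state, jointly with the channels. -/
theorem integral_past_state (hW : IsWhiteNoise W) (R : Realization act sen W s Pr)
    (Γ : Mode N I → Matrix s s 𝕜) (S : Mode N I → Matrix s (Fin nw) 𝕜) {K k : ℕ} (hk : k ≤ K)
    {g : ChannelPath N I → 𝕜} (hg : ChannelPath.Past K g) (i : s) :
    ∫ ω, g (R.path ω) * R.state Γ S k ω i ∂Pr =
      ∫ ω, g (R.path ω) * pathMean Γ (fun i => ∫ ω, R.x0 ω i ∂Pr) k (R.path ω) i ∂Pr := by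
  induction k generalizing g i with
  | zero =>
    have := R.integral_past_x0 hg (measurable_pi_apply i)
    simp only [pathMean, integral_mul_const]
    exact this
  | succ k ih =>
    have hg' : ∀ a, ChannelPath.Past K fun τ =>
        g τ * Matrix.fromCols (Γ (τ.mode k)) (S (τ.mode k)) i a := fun a =>
      hg.map₂ (fun x m => x * Matrix.fromCols (Γ m) (S m) i a) (ChannelPath.past_mode (by omega))
    have hm : ∀ a, ChannelPath.Past K fun τ =>
        pathMean Γ (fun i => ∫ ω, R.x0 ω i ∂Pr) k τ a := fun a =>
      ((past_pathMean Γ _ k).mono (by omega)).map fun x => x a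
    have hexp : ∀ ω, g (R.path ω) * R.state Γ S (k + 1) ω i =
        ∑ a, g (R.path ω) * Matrix.fromCols (Γ ((R.path ω).mode k)) (S ((R.path ω).mode k)) i a *
          R.extendedState Γ S k ω a := by
      intro ω
      rw [R.state_succ, Finset.mul_sum]
      exact Finset.sum_congr rfl fun a _ => by ring
    have hexp' : ∀ τ, g τ * pathMean Γ (fun i => ∫ ω, R.x0 ω i ∂Pr) (k + 1) τ i =
        ∑ a, g τ * Matrix.fromCols (Γ (τ.mode k)) (S (τ.mode k)) i (Sum.inl a) *
          pathMean Γ (fun i => ∫ ω, R.x0 ω i ∂Pr) k τ a := by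
      intro τ
      simp only [pathMean, Matrix.mulVec, dotProduct, Finset.mul_sum, Matrix.fromCols_apply_inl]
      exact Finset.sum_congr rfl fun a _ => by ring
    simp only [hexp, hexp']
    rw [integral_finsetSum _ fun a _ => (R.memLp_mul_past (hg' a)
        (R.memLp_extendedState hW Γ S k a)).integrable one_le_two,
      integral_finsetSum _ fun a _ => R.integrable_past ((hg' (Sum.inl a)).map₂ (· * ·) (hm a)),
      Fintype.sum_sum_type]
    have h0 : ∀ b, ∫ ω, g (R.path ω) * Matrix.fromCols (Γ ((R.path ω).mode k))
        (S ((R.path ω).mode k)) i (Sum.inr b) * R.extendedState Γ S k ω (Sum.inr b) ∂Pr = 0 :=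
      fun b => R.integral_past_noise hW (hg' (Sum.inr b)) k b
    simp only [h0, Finset.sum_const_zero, add_zero]
    exact Finset.sum_congr rfl fun a _ => ih (by omega) (hg' (Sum.inl a)) a

end Realization

end Moments

section ModeCovariance

variable {𝕜 : Type} [RCLike 𝕜] {N I nw : ℕ} {act : MarkovChannel N} {sen : MarkovChannel I}
  {W : Measure (ℕ → Fin nw → 𝕜)} {s : Type} [Fintype s] {Ω : Type} [MeasurableSpace Ω]
  {Pr : Measure Ω}

/-- Contribution of the noise to the second moments, when the modes have distribution `π`. -/
def noiseInput (act : MarkovChannel N) (sen : MarkovChannel I)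
    (S : Mode N I → Matrix s (Fin nw) 𝕜) (π : Fin N × Fin I → 𝕜) (z' : Fin N × Fin I) :
    Matrix s s 𝕜 :=
  ∑ z, ∑ l, (jointStep act sen z l z' : 𝕜) •
    (π z • (S (stepMode z l z') * (S (stepMode z l z')).conjTranspose))

namespace Realization

/-- Probability of the pair of modes `z` at time `k`. -/
noncomputable def modeProb (R : Realization act sen W s Pr) (k : ℕ) (z : Fin N × Fin I) : 𝕜 :=
  ∫ ω, (if (R.path ω).modes k = z then (1 : 𝕜) else 0) ∂Pr

/-- Second moment at time `k + 1` on the event that the pair of modes at time `k` is `z`, from the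
initial second moment `C`. -/
noncomputable def modeCov (R : Realization act sen W s Pr) (Γ : Mode N I → Matrix s s 𝕜)
    (S : Mode N I → Matrix s (Fin nw) 𝕜) (C : Matrix s s 𝕜) (k : ℕ) (z : Fin N × Fin I) :
    Matrix s s 𝕜 :=
  Matrix.of fun i j => ∫ ω, (if (R.path ω).modes k = z then (1 : 𝕜) else 0) *
    pathCov Γ S C (k + 1) (R.path ω) i j ∂Pr

theorem past_ite_modes {K k : ℕ} (hk : k < K) (z : Fin N × Fin I) :
    ChannelPath.Past K fun τ : ChannelPath N I => if τ.modes k = z then (1 : 𝕜) else 0 :=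
  (ChannelPath.past_modes hk).map fun a => if a = z then (1 : 𝕜) else 0

theorem past_pathCov_apply (Γ : Mode N I → Matrix s s 𝕜) (S : Mode N I → Matrix s (Fin nw) 𝕜)
    (C : Matrix s s 𝕜) {K k : ℕ} (hk : k ≤ K) (i j : s) :
    ChannelPath.Past K fun τ : ChannelPath N I => pathCov Γ S C k τ i j :=
  ((past_pathCov Γ S C k).mono hk).map fun X => X i j

theorem integral_mul_mul_apply {f : Ω → Matrix s s 𝕜} (hf : ∀ a b, Integrable (fun ω => f ω a b) Pr)
    (A B : Matrix s s 𝕜) (i j : s) :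
    Integrable (fun ω => (A * f ω * B) i j) Pr ∧
    ∫ ω, (A * f ω * B) i j ∂Pr = (A * Matrix.of (fun a b => ∫ ω, f ω a b ∂Pr) * B) i j := by
  have hint : ∀ a b, Integrable (fun ω => A i a * f ω a b * B b j) Pr := fun a b =>
    ((hf a b).const_mul _).mul_const _
  simp only [Matrix.mul_apply, Matrix.of_apply, Finset.sum_mul]
  refine ⟨integrable_finsetSum _ fun b _ => integrable_finsetSum _ fun a _ => hint a b, ?_⟩
  rw [integral_finsetSum _ fun b _ => integrable_finsetSum _ fun a _ => hint a b]
  refine Finset.sum_congr rfl fun b _ => ?_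
  rw [integral_finsetSum _ fun a _ => hint a b]
  refine Finset.sum_congr rfl fun a _ => ?_
  rw [integral_mul_const, integral_const_mul]

variable [IsProbabilityMeasure Pr]

/-- The Markov property on the event that the pair of modes at time `k` is `z`. -/
theorem markov_modes (R : Realization act sen W s Pr) (k : ℕ) {φ : ChannelPath N I → 𝕜}
    (hφ : ChannelPath.Past (k + 1) φ) (z z' : Fin N × Fin I) (l : Bool × Bool) :
    ∫ ω, (if (R.path ω).modes k = z then (1 : 𝕜) else 0) * φ (R.path ω) *
      (if (R.path ω).modes (k + 1) = z' ∧ (R.path ω).packets (k + 1) = l then 1 else 0) ∂Pr =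
    (jointStep act sen z l z' : 𝕜) *
      ∫ ω, (if (R.path ω).modes k = z then (1 : 𝕜) else 0) * φ (R.path ω) ∂Pr := by
  rw [R.markov k ((past_ite_modes (Nat.lt_succ_self k) z).map₂ (· * ·) hφ), ← integral_const_mul]
  refine integral_congr_ae (Eventually.of_forall fun ω => ?_)
  by_cases h : (R.path ω).modes k = z
  · simp only [h, if_true]
    ring
  · simp only [h, if_false]
    ring

theorem modeProb_succ (R : Realization act sen W s Pr) (k : ℕ) (z' : Fin N × Fin I) :
    R.modeProb (k + 1) z' =
      ∑ z, ((act.P z.1 z'.1 * sen.P z.2 z'.2 : ℝ) : 𝕜) * R.modeProb k z := by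
  have hexp : ∀ ω, (if (R.path ω).modes (k + 1) = z' then (1 : 𝕜) else 0) =
      ∑ z, ∑ l, (if (R.path ω).modes k = z then (1 : 𝕜) else 0) * 1 *
        (if (R.path ω).modes (k + 1) = z' ∧ (R.path ω).packets (k + 1) = l then 1 else 0) := by
    intro ω
    rw [Finset.sum_eq_single ((R.path ω).modes k) (fun z _ hz => by simp [hz.symm]) (by simp),
      Finset.sum_eq_single ((R.path ω).packets (k + 1)) (fun l _ hl => by simp [hl.symm]) (by simp)]
    simp
  have hint : ∀ z l, Integrable (fun ω => (if (R.path ω).modes k = z then (1 : 𝕜) else 0) * 1 *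
      (if (R.path ω).modes (k + 1) = z' ∧ (R.path ω).packets (k + 1) = l then 1 else 0)) Pr := by
    intro z l
    exact R.integrable_past (K := k + 2) (((past_ite_modes (by omega) z).map (· * 1)).map₂ (· * ·)
      ((ChannelPath.past_modes (Nat.lt_succ_self (k + 1))).map₂
        (fun a b => if a = z' ∧ b = l then (1 : 𝕜) else 0)
        (ChannelPath.past_packets (Nat.lt_succ_self (k + 1)))))
  rw [modeProb]
  simp only [hexp]
  rw [integral_finsetSum _ fun z _ => integrable_finsetSum _ fun l _ => hint z l]
  refine Finset.sum_congr rfl fun z _ => ?_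
  rw [integral_finsetSum _ fun l _ => hint z l, ← sum_jointStep_packet, RCLike.ofReal_sum,
    Finset.sum_mul]
  refine Finset.sum_congr rfl fun l _ => ?_
  rw [R.markov_modes k (φ := fun _ => 1) (ChannelPath.past_const 1) z z' l]
  simp only [mul_one, modeProb]

theorem sum_modeProb (R : Realization act sen W s Pr) (k : ℕ) : ∑ z, R.modeProb k z = 1 := by
  simp only [modeProb]
  rw [← integral_finsetSum _ fun z _ =>
    R.integrable_past (K := k + 1) (past_ite_modes (Nat.lt_succ_self k) z)]
  simp

theorem modeProb_eq (R : Realization act sen W s Pr) (k : ℕ) (z' : Fin N × Fin I) :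
    R.modeProb k z' =
      ∑ z, (((act.P ^ k) z.1 z'.1 * (sen.P ^ k) z.2 z'.2 : ℝ) : 𝕜) * R.modeProb 0 z := by
  induction k generalizing z' with
  | zero =>
    rw [Finset.sum_eq_single z']
    · simp
    · rintro ⟨i, n⟩ - hz
      have : ¬ (i = z'.1 ∧ n = z'.2) := fun h => hz (Prod.ext h.1 h.2)
      rcases not_and_or.1 this with h | h <;> simp [Matrix.one_apply, h]
    · simp
  | succ k ih =>
    rw [modeProb_succ]
    simp only [ih, Finset.mul_sum]
    rw [Finset.sum_comm]
    refine Finset.sum_congr rfl fun z _ => ?_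
    rw [pow_succ, pow_succ, Matrix.mul_apply, Matrix.mul_apply, Finset.sum_mul_sum,
      Fintype.sum_prod_type]
    push_cast
    simp only [Finset.sum_mul]
    exact Finset.sum_congr rfl fun a _ => Finset.sum_congr rfl fun b _ => by ring

/-- Ergodicity of the channels. -/
theorem tendsto_modeProb (R : Realization act sen W s Pr) {π : Fin N → ℝ} {ρ : Fin I → ℝ}
    (hπ : ∀ i j, Tendsto (fun k : ℕ => (act.P ^ k) i j) atTop (𝓝 (π j)))
    (hρ : ∀ i j, Tendsto (fun k : ℕ => (sen.P ^ k) i j) atTop (𝓝 (ρ j))) :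
    Tendsto R.modeProb atTop (𝓝 fun z => ((π z.1 * ρ z.2 : ℝ) : 𝕜)) := by
  refine tendsto_pi_nhds.2 fun z' => ?_
  have h : Tendsto (fun k => ∑ z : Fin N × Fin I,
      (((act.P ^ k) z.1 z'.1 * (sen.P ^ k) z.2 z'.2 : ℝ) : 𝕜) * R.modeProb 0 z) atTop
      (𝓝 (∑ z, ((π z'.1 * ρ z'.2 : ℝ) : 𝕜) * R.modeProb 0 z)) :=
    tendsto_finsetSum _ fun z _ =>
      (((RCLike.continuous_ofReal (K := 𝕜)).tendsto _).comp ((hπ _ _).mul (hρ _ _))).mul_const _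
  rw [← Finset.mul_sum, R.sum_modeProb, mul_one] at h
  exact h.congr fun k => (R.modeProb_eq k z').symm

/-- The second moments, split by the modes, obey a linear recursion. -/
theorem modeCov_succ (R : Realization act sen W s Pr) (Γ : Mode N I → Matrix s s 𝕜)
    (S : Mode N I → Matrix s (Fin nw) 𝕜) (C : Matrix s s 𝕜) (k : ℕ) :
    R.modeCov Γ S C (k + 1) =
      momentOp (jointStep act sen) (fun z l z' => Γ (stepMode z l z')) (R.modeCov Γ S C k) +
        noiseInput act sen S (R.modeProb k) := by
  funext z'
  ext i j
  let φ : Fin N × Fin I → Bool × Bool → ChannelPath N I → 𝕜 := fun z l τ =>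
    (Γ (stepMode z l z') * pathCov Γ S C (k + 1) τ * (Γ (stepMode z l z')).conjTranspose +
      S (stepMode z l z') * (S (stepMode z l z')).conjTranspose) i j
  have hφ : ∀ z l, ChannelPath.Past (k + 1) (φ z l) := fun z l =>
    (past_pathCov Γ S C (k + 1)).map fun X => (Γ (stepMode z l z') * X *
      (Γ (stepMode z l z')).conjTranspose +
      S (stepMode z l z') * (S (stepMode z l z')).conjTranspose) i j
  have hexp : ∀ ω, (if (R.path ω).modes (k + 1) = z' then (1 : 𝕜) else 0) *
      pathCov Γ S C (k + 1 + 1) (R.path ω) i j =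
      ∑ z, ∑ l, (if (R.path ω).modes k = z then (1 : 𝕜) else 0) * φ z l (R.path ω) *
        (if (R.path ω).modes (k + 1) = z' ∧ (R.path ω).packets (k + 1) = l then 1 else 0) := by
    intro ω
    rw [Finset.sum_eq_single ((R.path ω).modes k) (fun z _ hz => by simp [hz.symm]) (by simp),
      Finset.sum_eq_single ((R.path ω).packets (k + 1)) (fun l _ hl => by simp [hl.symm]) (by simp)]
    by_cases h : (R.path ω).modes (k + 1) = z'
    · subst h
      simp only [if_true, true_and, one_mul, mul_one]
      rfl
    · simp [h]
  have hint : ∀ z l, Integrable (fun ω => (if (R.path ω).modes k = z then (1 : 𝕜) else 0) *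
      φ z l (R.path ω) *
      (if (R.path ω).modes (k + 1) = z' ∧ (R.path ω).packets (k + 1) = l then 1 else 0)) Pr := by
    intro z l
    exact R.integrable_past (K := k + 2) (((past_ite_modes (by omega) z).map₂ (· * ·)
      ((hφ z l).mono (by omega))).map₂ (· * ·)
      ((ChannelPath.past_modes (Nat.lt_succ_self (k + 1))).map₂
        (fun a b => if a = z' ∧ b = l then (1 : 𝕜) else 0)
        (ChannelPath.past_packets (Nat.lt_succ_self (k + 1)))))
  have hval : ∀ z l, ∫ ω, (if (R.path ω).modes k = z then (1 : 𝕜) else 0) *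
      φ z l (R.path ω) ∂Pr = (Γ (stepMode z l z') * R.modeCov Γ S C k z *
        (Γ (stepMode z l z')).conjTranspose) i j + R.modeProb k z *
        (S (stepMode z l z') * (S (stepMode z l z')).conjTranspose) i j := by
    intro z l
    have h1 := integral_mul_mul_apply (Pr := Pr)
      (f := fun ω => (if (R.path ω).modes k = z then (1 : 𝕜) else 0) •
        pathCov Γ S C (k + 1) (R.path ω))
      (fun a b => R.integrable_past (K := k + 1) ((past_ite_modes (Nat.lt_succ_self k) z).map₂
        (· * ·) (past_pathCov_apply Γ S C le_rfl a b)))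
      (Γ (stepMode z l z')) (Γ (stepMode z l z')).conjTranspose i j
    have h2 := (R.integrable_past (K := k + 1)
      (past_ite_modes (𝕜 := 𝕜) (Nat.lt_succ_self k) z)).mul_const
      ((S (stepMode z l z') * (S (stepMode z l z')).conjTranspose) i j)
    have h3 : ∀ ω, (if (R.path ω).modes k = z then (1 : 𝕜) else 0) * φ z l (R.path ω) =
        (Γ (stepMode z l z') * ((if (R.path ω).modes k = z then (1 : 𝕜) else 0) •
          pathCov Γ S C (k + 1) (R.path ω)) * (Γ (stepMode z l z')).conjTranspose) i j +
        (if (R.path ω).modes k = z then (1 : 𝕜) else 0) *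
          (S (stepMode z l z') * (S (stepMode z l z')).conjTranspose) i j := by
      intro ω
      simp only [φ, Matrix.add_apply, Matrix.mul_smul, Matrix.smul_mul, Matrix.smul_apply,
        smul_eq_mul, mul_add]
    simp only [h3]
    rw [integral_add h1.1 h2, h1.2, integral_mul_const]
    rfl
  have hL : R.modeCov Γ S C (k + 1) z' i j = ∑ z, ∑ l, (jointStep act sen z l z' : 𝕜) *
      ((Γ (stepMode z l z') * R.modeCov Γ S C k z * (Γ (stepMode z l z')).conjTranspose) i j +
        R.modeProb k z * (S (stepMode z l z') * (S (stepMode z l z')).conjTranspose) i j) := by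
    rw [modeCov, Matrix.of_apply]
    simp only [hexp]
    rw [integral_finsetSum _ fun z _ => integrable_finsetSum _ fun l _ => hint z l]
    refine Finset.sum_congr rfl fun z _ => ?_
    rw [integral_finsetSum _ fun l _ => hint z l]
    refine Finset.sum_congr rfl fun l _ => ?_
    rw [R.markov_modes k (hφ z l), hval]
  rw [hL]
  simp only [momentOp, noiseInput, LinearMap.coe_mk, AddHom.coe_mk, Pi.add_apply,
    Matrix.add_apply, Matrix.sum_apply, Matrix.smul_apply, smul_eq_mul, mul_add,
    Finset.sum_add_distrib]

/-- The second moment of the state is the sum over the modes. -/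
theorem integral_state_mul_star (hW : IsWhiteNoise W) (R : Realization act sen W s Pr)
    (Γ : Mode N I → Matrix s s 𝕜) (S : Mode N I → Matrix s (Fin nw) 𝕜) (k : ℕ) (i j : s) :
    ∫ ω, R.state Γ S (k + 1) ω i * star (R.state Γ S (k + 1) ω j) ∂Pr =
      ∑ z, R.modeCov Γ S (Matrix.of fun i j => ∫ ω, R.x0 ω i * star (R.x0 ω j) ∂Pr) k z i j := by
  have h := R.integral_past_state_state hW Γ S (le_refl (k + 1))
    (g := fun _ => 1) (ChannelPath.past_const 1) i j
  simp only [one_mul] at h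
  rw [h]
  simp only [modeCov, Matrix.of_apply]
  rw [← integral_finsetSum _ fun z _ => R.integrable_past (K := k + 1)
    ((past_ite_modes (Nat.lt_succ_self k) z).map₂ (· * ·) (past_pathCov_apply Γ S _ le_rfl i j))]
  simp only [← Finset.sum_mul]
  simp

theorem sum_modeCov_outer (R : Realization act sen W s Pr) (Γ : Mode N I → Matrix s s 𝕜)
    (m : s → 𝕜) (k : ℕ) (i : s) :
    ∑ z, R.modeCov Γ (fun _ => (0 : Matrix s (Fin nw) 𝕜)) (outer m m) k z i i =
      ((∫ ω, ‖pathMean Γ m (k + 1) (R.path ω) i‖ ^ 2 ∂Pr : ℝ) : 𝕜) := by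
  simp only [modeCov, Matrix.of_apply]
  rw [← integral_finsetSum _ fun z _ => R.integrable_past (K := k + 1)
    ((past_ite_modes (Nat.lt_succ_self k) z).map₂ (· * ·)
      (past_pathCov_apply Γ _ _ le_rfl i i))]
  simp only [← Finset.sum_mul, pathCov_outer]
  rw [← integral_ofReal]
  refine integral_congr_ae (Eventually.of_forall fun ω => ?_)
  simp [outer, RCLike.mul_conj]

end Realization

theorem norm_integral_sq_le {f : Ω → 𝕜} [IsProbabilityMeasure Pr] (hf : MemLp f 2 Pr) :
    ‖∫ ω, f ω ∂Pr‖ ^ 2 ≤ ∫ ω, ‖f ω‖ ^ 2 ∂Pr := by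
  have h1 : ‖∫ ω, f ω ∂Pr‖ ^ 2 ≤ (∫ ω, ‖f ω‖ ∂Pr) ^ 2 :=
    pow_le_pow_left₀ (norm_nonneg _) (norm_integral_le_integral_norm _) 2
  have h2 := variance_eq_sub hf.norm
  have h3 := variance_nonneg (fun ω => ‖f ω‖) Pr
  rw [h2] at h3
  simp only [Pi.pow_apply] at h3
  linarith

attribute [local instance] Matrix.normedAddCommGroup Matrix.normedSpace in
/-- A jump linear system that is stable without noise is mean square stable. -/
theorem NoiselessStable.meanSquareStable (hW : IsWhiteNoise W) {Γ : Mode N I → Matrix s s 𝕜}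
    (h : NoiselessStable act sen Γ) (S : Mode N I → Matrix s (Fin nw) 𝕜) :
    MeanSquareStable act sen W Γ S := by
  obtain ⟨π, -, hπ⟩ := act.ergodic
  obtain ⟨ρ, -, hρ⟩ := sen.ergodic
  have hT := (energyStable_iff_momentOp (jointStep_nonneg act sen)).1 h
  set u := noiseInput act sen S fun z => ((π z.1 * ρ z.2 : ℝ) : 𝕜) with hu
  obtain ⟨L, hL⟩ := exists_tendsto_of_affine_recursion _ hT u
  refine ⟨0, ∑ z, L z, fun Ω _ Pr _ R => ⟨?_, ?_⟩⟩
  · rw [← tendsto_add_atTop_iff_nat 1]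
    refine tendsto_pi_nhds.2 fun i => ?_
    set m : s → 𝕜 := fun i => ∫ ω, R.x0 ω i ∂Pr with hm
    have hmean : ∀ k, ∫ ω, R.state Γ S (k + 1) ω i ∂Pr =
        ∫ ω, pathMean Γ m (k + 1) (R.path ω) i ∂Pr := by
      intro k
      simpa using R.integral_past_state hW Γ S (le_refl (k + 1)) (g := fun _ => 1)
        (ChannelPath.past_const 1) i
    obtain ⟨L0, hL0⟩ := exists_tendsto_of_affine_recursion _ hT 0
    have hL0' : L0 = 0 :=
      tendsto_nhds_unique (hL0 (fun _ => 0) (fun _ => 0) (by simp) tendsto_const_nhds)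
        tendsto_const_nhds
    have hcov := hL0 (R.modeCov Γ (fun _ => (0 : Matrix s (Fin nw) 𝕜)) (outer m m)) (fun _ => 0)
      (fun k => by
        rw [R.modeCov_succ]
        congr 1
        funext z'
        simp [noiseInput]) tendsto_const_nhds
    rw [hL0'] at hcov
    have hsum : Tendsto (fun k => ∑ z, R.modeCov Γ (fun _ => (0 : Matrix s (Fin nw) 𝕜))
        (outer m m) k z i i) atTop (𝓝 (∑ z : Fin N × Fin I, (0 : 𝕜))) :=
      tendsto_finsetSum _ fun z _ =>
        tendsto_pi_nhds.1 (tendsto_pi_nhds.1 (tendsto_pi_nhds.1 hcov z) i) i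
    simp only [R.sum_modeCov_outer, Finset.sum_const_zero] at hsum
    have hsq := hsum.norm
    simp only [RCLike.norm_ofReal, norm_zero] at hsq
    have hlim : Tendsto (fun k => ‖∫ ω, R.state Γ S (k + 1) ω i ∂Pr‖ ^ 2) atTop (𝓝 0) := by
      refine squeeze_zero (fun k => by positivity) (fun k => ?_) hsq
      rw [hmean]
      have hpast : ChannelPath.Past (k + 1) fun τ : ChannelPath N I => pathMean Γ m (k + 1) τ i :=
        (past_pathMean Γ m (k + 1)).map fun x => x i
      obtain ⟨C, hC⟩ := hpast.exists_norm_le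
      have hmem : MemLp (fun ω => pathMean Γ m (k + 1) (R.path ω) i) 2 Pr :=
        MemLp.of_bound (hpast.measurable.comp R.measurable_path).aestronglyMeasurable C
          (Eventually.of_forall fun ω => hC _)
      exact (norm_integral_sq_le hmem).trans (le_abs_self _)
    rw [Pi.zero_apply, tendsto_zero_iff_norm_tendsto_zero]
    have := hlim.sqrt
    simpa [Real.sqrt_sq (norm_nonneg _)] using this
  · rw [← tendsto_add_atTop_iff_nat 1]
    have hinput : Tendsto (fun k => noiseInput act sen S (R.modeProb k)) atTop (𝓝 u) := by
      refine tendsto_pi_nhds.2 fun z' => ?_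
      exact tendsto_finsetSum _ fun z _ => tendsto_finsetSum _ fun l _ =>
        ((tendsto_pi_nhds.1 (R.tendsto_modeProb hπ hρ) z).smul_const _).const_smul _
    have hX := hL (R.modeCov Γ S (Matrix.of fun i j => ∫ ω, R.x0 ω i * star (R.x0 ω j) ∂Pr)) _
      (fun k => R.modeCov_succ Γ S _ k) hinput
    refine tendsto_pi_nhds.2 fun i => tendsto_pi_nhds.2 fun j => ?_
    have hsum := tendsto_finsetSum Finset.univ fun (z : Fin N × Fin I) _ =>
      tendsto_pi_nhds.1 (tendsto_pi_nhds.1 (tendsto_pi_nhds.1 hX z) i) j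
    rw [Matrix.sum_apply]
    exact hsum.congr fun k => (R.integral_state_mul_star hW Γ S k i j).symm

/-- From the mode `z` at time `-1`, the influence of the initial second moment is described by
the second moment operator. -/
theorem Realization.modeCov_sub_of_start [IsProbabilityMeasure Pr]
    (R : Realization act sen W s Pr) (z : Fin N × Fin I) (hpast : ∀ ω, R.θpast ω = z.1)
    (hstart : ∀ z' l, ∫ ω, (if (R.path ω).modes 0 = z' ∧ (R.path ω).packets 0 = l
      then (1 : 𝕜) else 0) ∂Pr = (jointStep act sen z l z' : 𝕜))
    (Γ : Mode N I → Matrix s s 𝕜) (S : Mode N I → Matrix s (Fin nw) 𝕜) (C : Matrix s s 𝕜) (k : ℕ) :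
    R.modeCov Γ S C k - R.modeCov Γ S 0 k =
      (momentOp (jointStep act sen) (fun z l z' => Γ (stepMode z l z')) ^ (k + 1))
        (Pi.single z C) := by
  induction k with
  | succ k ih =>
    rw [modeCov_succ, modeCov_succ, add_sub_add_right_eq_sub, ← map_sub, ih, pow_succ' _ (k + 1),
      Module.End.mul_apply]
  | zero =>
    have hmode : ∀ ω, (R.path ω).mode 0 =
        stepMode z ((R.path ω).packets 0) ((R.path ω).modes 0) := by
      intro ω
      rw [ChannelPath.mode, stepMode]
      simp only [ChannelPath.packets, ChannelPath.modes, Mode.mk.injEq, true_and, and_true]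
      exact hpast ω
    have hval : ∀ (C : Matrix s s 𝕜) z' i j, R.modeCov Γ S C 0 z' i j =
        ∑ l, (jointStep act sen z l z' : 𝕜) *
          (Γ (stepMode z l z') * C * (Γ (stepMode z l z')).conjTranspose +
            S (stepMode z l z') * (S (stepMode z l z')).conjTranspose) i j := by
      intro C z' i j
      have hexp : ∀ ω, (if (R.path ω).modes 0 = z' then (1 : 𝕜) else 0) *
          pathCov Γ S C (0 + 1) (R.path ω) i j =
          ∑ l, (if (R.path ω).modes 0 = z' ∧ (R.path ω).packets 0 = l then (1 : 𝕜) else 0) *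
            (Γ (stepMode z l z') * C * (Γ (stepMode z l z')).conjTranspose +
            S (stepMode z l z') * (S (stepMode z l z')).conjTranspose) i j := by
        intro ω
        rw [Finset.sum_eq_single ((R.path ω).packets 0) (fun l _ hl => by simp [hl.symm]) (by simp)]
        by_cases h : (R.path ω).modes 0 = z'
        · subst h
          simp only [if_true, true_and, pathCov, hmode]
        · simp [h]
      have hint : ∀ l, Integrable (fun ω => (if (R.path ω).modes 0 = z' ∧
          (R.path ω).packets 0 = l then (1 : 𝕜) else 0) *
            (Γ (stepMode z l z') * C * (Γ (stepMode z l z')).conjTranspose +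
            S (stepMode z l z') * (S (stepMode z l z')).conjTranspose) i j) Pr := fun l =>
        (R.integrable_past (K := 1) ((ChannelPath.past_modes one_pos).map₂
          (fun a b => if a = z' ∧ b = l then (1 : 𝕜) else 0)
          (ChannelPath.past_packets one_pos))).mul_const _
      rw [modeCov, Matrix.of_apply]
      simp only [hexp]
      rw [integral_finsetSum _ fun l _ => hint l]
      refine Finset.sum_congr rfl fun l _ => ?_
      rw [integral_mul_const, hstart]
    funext z'
    ext i j
    rw [Pi.sub_apply, Matrix.sub_apply, hval, hval, ← Finset.sum_sub_distrib, zero_add, pow_one]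
    simp only [momentOp, LinearMap.coe_mk, AddHom.coe_mk]
    rw [Finset.sum_eq_single z (fun y _ hy => by simp [Pi.single_eq_of_ne hy]) (by simp)]
    simp only [Pi.single_eq_same, Matrix.sum_apply, Matrix.smul_apply, smul_eq_mul,
      Matrix.add_apply, Matrix.mul_zero, Matrix.zero_mul, Matrix.zero_apply, zero_add]
    exact Finset.sum_congr rfl fun l _ => by ring

end ModeCovariance

section Construction

variable {N I : ℕ}

/-- The law of the next mode and packet of a channel, from the mode `h`. -/
noncomputable def MarkovChannel.stepMeasure (ch : MarkovChannel N) (h : Fin N) :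
    Measure (Fin N × Bool) :=
  (PMF.ofFintype (fun x : Fin N × Bool => ENNReal.ofReal (ch.step h x.2 x.1)) (by
    rw [← ENNReal.ofReal_sum_of_nonneg fun x _ => ch.step_nonneg _ _ _, Fintype.sum_prod_type,
      ch.sum_step, ENNReal.ofReal_one])).toMeasure

instance (ch : MarkovChannel N) (h : Fin N) : IsProbabilityMeasure (ch.stepMeasure h) := by
  unfold MarkovChannel.stepMeasure
  infer_instance

/-- The law of independent, identically distributed random maps whose iterates are runs of the
channel. -/
noncomputable def MarkovChannel.mapsMeasure (ch : MarkovChannel N) :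
    Measure (ℕ → Fin N → Fin N × Bool) :=
  Measure.infinitePi fun _ => Measure.pi ch.stepMeasure

instance (ch : MarkovChannel N) : IsProbabilityMeasure ch.mapsMeasure := by
  unfold MarkovChannel.mapsMeasure
  infer_instance

/-- The modes and packets obtained by iterating the maps `f` from the mode `h`. -/
def iterateMaps (h : Fin N) (f : ℕ → Fin N → Fin N × Bool) : ℕ → Fin N × Bool
  | 0 => f 0 h
  | k + 1 => f (k + 1) (iterateMaps h f k).1

theorem measurable_iterateMaps (h : Fin N) (k : ℕ) :
    Measurable fun f : ℕ → Fin N → Fin N × Bool => iterateMaps h f k := by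
  induction k with
  | zero => exact (measurable_pi_apply h).comp (measurable_pi_apply 0)
  | succ k ih =>
    have h1 : Measurable fun q : (Fin N → Fin N × Bool) × (Fin N × Bool) => q.1 q.2.1 :=
      Measurable.of_discrete
    exact h1.comp ((measurable_pi_apply (k + 1)).prodMk ih)

/-- The mode before time `t` of a trajectory that starts from the mode `h`. -/
def previousMode (h : Fin N) (τ : ℕ → Fin N × Bool) : ℕ → Fin N
  | 0 => h
  | t + 1 => (τ t).1

theorem iterateMaps_eq_iff (h : Fin N) (f : ℕ → Fin N → Fin N × Bool) (τ : ℕ → Fin N × Bool)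
    (K : ℕ) : (∀ t < K, iterateMaps h f t = τ t) ↔ ∀ t < K, f t (previousMode h τ t) = τ t := by
  induction K with
  | zero => simp
  | succ K ih =>
    rw [Nat.forall_lt_succ_right, Nat.forall_lt_succ_right, ih]
    refine and_congr_right fun hK => ?_
    cases K with
    | zero => rfl
    | succ K =>
      have := (ih.2 hK) K (Nat.lt_succ_self K)
      simp only [iterateMaps, previousMode, this]

theorem MarkovChannel.mapsMeasure_iterate (ch : MarkovChannel N) (h : Fin N)
    (τ : ℕ → Fin N × Bool) (K : ℕ) :
    ch.mapsMeasure.real {f | ∀ t < K, iterateMaps h f t = τ t} =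
      ∏ t ∈ Finset.range K, ch.step (previousMode h τ t) (τ t).2 (τ t).1 := by
  have hset : {f : ℕ → Fin N → Fin N × Bool | ∀ t < K, iterateMaps h f t = τ t} =
      Set.pi (Finset.range K : Set ℕ) fun t => {g | g (previousMode h τ t) = τ t} := by
    ext f
    simp [iterateMaps_eq_iff, Set.mem_pi]
  have hone : ∀ t, (Measure.pi ch.stepMeasure) {g | g (previousMode h τ t) = τ t} =
      ENNReal.ofReal (ch.step (previousMode h τ t) (τ t).2 (τ t).1) := by
    intro t
    have h0 : MeasurePreserving (fun g : Fin N → Fin N × Bool => g (previousMode h τ t))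
        (Measure.pi ch.stepMeasure) (ch.stepMeasure (previousMode h τ t)) :=
      measurePreserving_eval _ _
    have h1 : (Measure.pi ch.stepMeasure) {g | g (previousMode h τ t) = τ t} =
        ch.stepMeasure (previousMode h τ t) {τ t} :=
      h0.measure_preimage (measurableSet_singleton (τ t)).nullMeasurableSet
    rw [h1, stepMeasure, PMF.toMeasure_apply_singleton _ _ (measurableSet_singleton _),
      PMF.ofFintype_apply]
  rw [hset, measureReal_def, mapsMeasure,
    Measure.infinitePi_pi _ fun t _ => (Set.toFinite _).measurableSet, ENNReal.toReal_prod]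
  refine Finset.prod_congr rfl fun t _ => ?_
  rw [hone, ENNReal.toReal_ofReal (ch.step_nonneg _ _ _)]

variable {Ω : Type} [MeasurableSpace Ω] {Pr : Measure Ω}

theorem MarkovChannel.prob_iterate {ch : MarkovChannel N} {f : Ω → ℕ → Fin N → Fin N × Bool}
    (hf : MeasurePreserving f Pr ch.mapsMeasure) (h : Fin N) (τ : ℕ → Fin N × Bool) (K : ℕ) :
    Pr.real {ω | ∀ t < K, iterateMaps h (f ω) t = τ t} =
      ∏ t ∈ Finset.range K, ch.step (previousMode h τ t) (τ t).2 (τ t).1 := by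
  have hm : MeasurableSet {f : ℕ → Fin N → Fin N × Bool | ∀ t < K, iterateMaps h f t = τ t} := by
    simp only [Set.ofPred_forall]
    exact MeasurableSet.iInter fun t => MeasurableSet.iInter fun _ =>
      measurable_iterateMaps h t (measurableSet_singleton (τ t))
  rw [← ch.mapsMeasure_iterate h τ K, measureReal_def, measureReal_def,
    ← hf.measure_preimage hm.nullMeasurableSet]
  rfl

/-- Iterated random maps form a run of the channel. -/
theorem MarkovChannel.isChannelRun_iterate [IsProbabilityMeasure Pr] {ch : MarkovChannel N}
    {f : Ω → ℕ → Fin N → Fin N × Bool}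
    (hf : MeasurePreserving f Pr ch.mapsMeasure) (h : Fin N) {α : Type} [MeasurableSpace α]
    (a₀ : α) :
    IsChannelRun ch Pr (fun _ => a₀) (fun k ω => (iterateMaps h (f ω) k).1)
      (fun k ω => (iterateMaps h (f ω) k).2) where
  measurable_past := measurable_const
  measurable_mode k := measurable_fst.comp ((measurable_iterateMaps h k).comp hf.measurable)
  measurable_recv k := measurable_snd.comp ((measurable_iterateMaps h k).comp hf.measurable)
  path_zero a i b := by
    by_cases ha : a₀ = a
    · have h1 : ∀ b, Pr.real {ω | iterateMaps h (f ω) 0 = (i, b)} = ch.step h b i := by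
        intro b
        simpa [previousMode] using prob_iterate hf h (fun _ => (i, b)) 1
      have hmeas : ∀ b, MeasurableSet {ω | iterateMaps h (f ω) 0 = (i, b)} := fun b =>
        ((measurable_iterateMaps h 0).comp hf.measurable) (measurableSet_singleton (i, b))
      have h2 : {ω | a₀ = a ∧ (iterateMaps h (f ω) 0).1 = i} =
          {ω | iterateMaps h (f ω) 0 = (i, true)} ∪ {ω | iterateMaps h (f ω) 0 = (i, false)} := by
        ext ω
        rcases hx : iterateMaps h (f ω) 0 with ⟨j, c⟩
        cases c <;> simp [ha, hx]
      have h3 : {ω | a₀ = a ∧ (iterateMaps h (f ω) 0).1 = i ∧ (iterateMaps h (f ω) 0).2 = b} =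
          {ω | iterateMaps h (f ω) 0 = (i, b)} := by
        ext ω
        simp [ha, Prod.ext_iff]
      have hd : Disjoint {ω | iterateMaps h (f ω) 0 = (i, true)}
          {ω | iterateMaps h (f ω) 0 = (i, false)} := by
        refine Set.disjoint_left.2 fun ω h1 h2 => ?_
        have := (show _ = (i, true) from h1).symm.trans h2
        simp at this
      rw [h2, h3, measureReal_union hd (hmeas false), h1, h1, h1,
        ← Fintype.sum_bool (fun b => ch.step h b i), sum_step_packet, step]
    · simp [ha]
  path_succ k a i b := by
    by_cases ha : a₀ = a
    · have h1 := prob_iterate hf h (fun t => (i t, b t)) (k + 1)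
      have h2 := prob_iterate hf h (fun t => (i t, b t)) (k + 1 + 1)
      have e : ∀ K, {ω | a₀ = a ∧ ∀ t ≤ K, (iterateMaps h (f ω) t).1 = i t ∧
          (iterateMaps h (f ω) t).2 = b t} =
          {ω | ∀ t < K + 1, iterateMaps h (f ω) t = (i t, b t)} := by
        intro K
        ext ω
        simp only [ha, true_and, Nat.lt_add_one_iff, Prod.ext_iff]
      rw [e, e, h1, h2, Finset.prod_range_succ _ (k + 1)]
      rfl
    · simp [ha]

theorem indepFun_comp_measurePreserving {Ω' α β : Type} [MeasurableSpace Ω'] [MeasurableSpace α]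
    [MeasurableSpace β] {μ : Measure Ω'} {q : Ω → Ω'} (hq : MeasurePreserving q Pr μ)
    {f : Ω' → α} {g : Ω' → β} (hf : Measurable f) (hg : Measurable g) (h : IndepFun f g μ) :
    IndepFun (fun ω => f (q ω)) (fun ω => g (q ω)) Pr := by
  rw [indepFun_iff_measure_inter_preimage_eq_mul] at h ⊢
  intro s t hs ht
  have := h s t hs ht
  rw [← hq.measure_preimage ((hf hs).inter (hg ht)).nullMeasurableSet,
    ← hq.measure_preimage (hf hs).nullMeasurableSet,
    ← hq.measure_preimage (hg ht).nullMeasurableSet] at this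
  exact this

variable {𝕜 : Type} [RCLike 𝕜] {nw : ℕ}

theorem measurePreserving_prod_fst {α β : Type} [MeasurableSpace α] [MeasurableSpace β]
    (μ : Measure α) (ν : Measure β) [IsProbabilityMeasure μ] [IsProbabilityMeasure ν] :
    MeasurePreserving Prod.fst (μ.prod ν) μ :=
  ⟨measurable_fst, by simp⟩

theorem measurePreserving_prod_snd {α β : Type} [MeasurableSpace α] [MeasurableSpace β]
    (μ : Measure α) (ν : Measure β) [IsProbabilityMeasure μ] [IsProbabilityMeasure ν] :
    MeasurePreserving Prod.snd (μ.prod ν) ν :=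
  ⟨measurable_snd, by simp⟩

/-- The sample space of random maps for both channels and of noise sequences. -/
abbrev CanonicalSpace (𝕜 : Type) (N I nw : ℕ) : Type :=
  ((ℕ → Fin N → Fin N × Bool) × (ℕ → Fin I → Fin I × Bool)) × (ℕ → Fin nw → 𝕜)

/-- The canonical measure: independent channels and noise. -/
noncomputable def canonicalMeasure (act : MarkovChannel N) (sen : MarkovChannel I)
    (W : Measure (ℕ → Fin nw → 𝕜)) : Measure (CanonicalSpace 𝕜 N I nw) :=
  (act.mapsMeasure.prod sen.mapsMeasure).prod W

instance (act : MarkovChannel N) (sen : MarkovChannel I)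
    (W : Measure (ℕ → Fin nw → 𝕜)) [IsProbabilityMeasure W] :
    IsProbabilityMeasure (canonicalMeasure act sen W) := by
  unfold canonicalMeasure
  infer_instance

variable {s : Type} [Fintype s]

/-- The realization with deterministic initial state `v` whose channels start from the pair of
modes `z` at time `-1`. -/
noncomputable def startRealization (act : MarkovChannel N) (sen : MarkovChannel I)
    (W : Measure (ℕ → Fin nw → 𝕜)) [IsProbabilityMeasure W] (z : Fin N × Fin I) (v : s → 𝕜) :
    Realization act sen W s (canonicalMeasure act sen W) where
  x0 := fun _ => v
  θpast := fun _ => z.1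
  θ := fun k ω => (iterateMaps z.1 ω.1.1 k).1
  ν := fun k ω => (iterateMaps z.1 ω.1.1 k).2
  η := fun k ω => (iterateMaps z.2 ω.1.2 k).1
  γ := fun k ω => (iterateMaps z.2 ω.1.2 k).2
  w := fun k ω => ω.2 k
  measurable_x0 := measurable_const
  memLp_x0 := memLp_const v
  actuation := MarkovChannel.isChannelRun_iterate (f := fun ω : CanonicalSpace 𝕜 N I nw => ω.1.1)
    ((measurePreserving_prod_fst _ _).comp (measurePreserving_prod_fst _ _)) z.1 z.1
  sensing := MarkovChannel.isChannelRun_iterate (f := fun ω : CanonicalSpace 𝕜 N I nw => ω.1.2)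
    ((measurePreserving_prod_snd _ _).comp (measurePreserving_prod_fst _ _)) z.2 ()
  measurable_w := fun k => (measurable_pi_apply k).comp measurable_snd
  law_w := (measurePreserving_prod_snd _ _).map_eq
  indep_act := indepFun_const_left _ _
  indep_sen := by
    have hX : Measurable fun f : ℕ → Fin N → Fin N × Bool =>
        (v, z.1, fun k => ((iterateMaps z.1 f k).1, (iterateMaps z.1 f k).2)) :=
      measurable_const.prodMk (measurable_const.prodMk
        (measurable_pi_lambda _ fun k => measurable_iterateMaps z.1 k))
    have hY : Measurable fun f : ℕ → Fin I → Fin I × Bool =>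
        fun k => ((iterateMaps z.2 f k).1, (iterateMaps z.2 f k).2) :=
      measurable_pi_lambda _ fun k => measurable_iterateMaps z.2 k
    exact indepFun_comp_measurePreserving (measurePreserving_prod_fst _ _)
      (hX.comp measurable_fst) (hY.comp measurable_snd) (indepFun_prod hX hY)
  indep_w := by
    have hX : Measurable fun f : (ℕ → Fin N → Fin N × Bool) × (ℕ → Fin I → Fin I × Bool) =>
        (v, (z.1, fun k => ((iterateMaps z.1 f.1 k).1, (iterateMaps z.1 f.1 k).2)),
          fun k => ((iterateMaps z.2 f.2 k).1, (iterateMaps z.2 f.2 k).2)) :=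
      measurable_const.prodMk ((measurable_const.prodMk
        (measurable_pi_lambda _ fun k => (measurable_iterateMaps z.1 k).comp measurable_fst)).prodMk
        (measurable_pi_lambda _ fun k => (measurable_iterateMaps z.2 k).comp measurable_snd))
    exact indepFun_prod (Y := fun w : ℕ → Fin nw → 𝕜 => fun k => w k) hX measurable_id

theorem startRealization_start (act : MarkovChannel N) (sen : MarkovChannel I)
    (W : Measure (ℕ → Fin nw → 𝕜)) [IsProbabilityMeasure W] (z : Fin N × Fin I) (v : s → 𝕜)
    (z' : Fin N × Fin I) (l : Bool × Bool) :
    ∫ ω, (if ((startRealization act sen W z v).path ω).modes 0 = z' ∧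
      ((startRealization act sen W z v).path ω).packets 0 = l then (1 : 𝕜) else 0)
        ∂(canonicalMeasure act sen W) = (jointStep act sen z l z' : 𝕜) := by
  set R := startRealization act sen W z v
  let τ : ChannelPath N I := ((z.1, fun _ => (z'.1, l.1)), fun _ => (z'.2, l.2))
  have hset : {ω | (R.path ω).modes 0 = z' ∧ (R.path ω).packets 0 = l} =
      {ω | (R.path ω).history 1 = τ.history 1} := by
    ext ω
    simp only [Set.mem_ofPred_eq, ChannelPath.history_eq_iff, Nat.lt_one_iff, forall_eq]
    simp only [ChannelPath.modes, ChannelPath.packets, Prod.ext_iff, τ]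
    have : (R.path ω).1.1 = z.1 := rfl
    tauto
  have hmeas : MeasurableSet {ω | (R.path ω).history 1 = τ.history 1} :=
    ((ChannelPath.measurable_history 1).comp R.measurable_path) (measurableSet_singleton _)
  have h1 := MarkovChannel.prob_iterate (Pr := canonicalMeasure act sen W) (f := fun ω => ω.1.1)
    ((measurePreserving_prod_fst _ _).comp (measurePreserving_prod_fst _ _)) z.1
    (fun _ => (z'.1, l.1)) 1
  have h2 := MarkovChannel.prob_iterate (Pr := canonicalMeasure act sen W) (f := fun ω => ω.1.2)
    ((measurePreserving_prod_snd _ _).comp (measurePreserving_prod_fst _ _)) z.2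
    (fun _ => (z'.2, l.2)) 1
  have hind : ∀ ω, (if (R.path ω).modes 0 = z' ∧ (R.path ω).packets 0 = l then (1 : 𝕜) else 0) =
      ({ω | (R.path ω).history 1 = τ.history 1}).indicator (fun _ => (1 : 𝕜)) ω := by
    intro ω
    rw [← hset, Set.indicator_apply]
    rfl
  simp only [hind]
  rw [integral_indicator_const _ hmeas, R.prob_history, RCLike.real_smul_eq_coe_mul, mul_one]
  congr 1
  simp only [Nat.lt_one_iff, forall_eq, Finset.range_one, Finset.prod_singleton, previousMode]
    at h1 h2 ⊢
  rw [jointStep, ← h1, ← h2]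
  congr 2
  · ext ω
    simp only [Set.mem_ofPred_eq, R, startRealization, τ, Prod.ext_iff, true_and]
  · ext ω
    simp only [Set.mem_ofPred_eq, R, startRealization, τ, Prod.ext_iff]

/-- A mean square stable jump linear system is stable without noise. -/
theorem MeanSquareStable.noiselessStable {act : MarkovChannel N} {sen : MarkovChannel I}
    {W : Measure (ℕ → Fin nw → 𝕜)} (hW : IsWhiteNoise W) {Γ : Mode N I → Matrix s s 𝕜}
    {S : Mode N I → Matrix s (Fin nw) 𝕜} (h : MeanSquareStable act sen W Γ S) :
    NoiselessStable act sen Γ := by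
  have := hW.isProbabilityMeasure
  obtain ⟨μe, Qe, hlim⟩ := h
  intro z v
  rw [← tendsto_add_atTop_iff_nat 1]
  set T := momentOp (jointStep act sen) fun z l z' => Γ (stepMode z l z')
  have hC : ∀ v : s → 𝕜, (Matrix.of fun i j =>
      ∫ ω, (startRealization act sen W z v).x0 ω i *
        star ((startRealization act sen W z v).x0 ω j) ∂(canonicalMeasure act sen W)) =
      outer v v := by
    intro v
    ext i j
    simp [startRealization, outer]
  have hdiff : ∀ k i j, ∑ y, (T ^ (k + 1)) (Pi.single z (outer v v)) y i j =
      ∫ ω, (startRealization act sen W z v).state Γ S (k + 1) ω i *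
        star ((startRealization act sen W z v).state Γ S (k + 1) ω j)
          ∂(canonicalMeasure act sen W) -
      ∫ ω, (startRealization act sen W z (0 : s → 𝕜)).state Γ S (k + 1) ω i *
        star ((startRealization act sen W z (0 : s → 𝕜)).state Γ S (k + 1) ω j)
          ∂(canonicalMeasure act sen W) := by
    intro k i j
    have h0 : outer (0 : s → 𝕜) 0 = 0 := by
      ext i j
      simp [outer]
    rw [Realization.integral_state_mul_star hW, Realization.integral_state_mul_star hW, hC, hC, h0,
      ← (startRealization act sen W z v).modeCov_sub_of_start z (fun _ => rfl)
        (startRealization_start act sen W z v) Γ S (outer v v) k]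
    simp only [Pi.sub_apply, Matrix.sub_apply, Finset.sum_sub_distrib]
    rfl
  have htrace : Tendsto (fun k => ∑ i, ∑ y, (T ^ (k + 1)) (Pi.single z (outer v v)) y i i) atTop
      (𝓝 (∑ i : s, (0 : 𝕜))) := by
    refine tendsto_finsetSum _ fun i _ => ?_
    have t1 := tendsto_pi_nhds.1 (tendsto_pi_nhds.1
      (hlim _ _ (startRealization act sen W z v)).2 i) i
    have t2 := tendsto_pi_nhds.1 (tendsto_pi_nhds.1
      (hlim _ _ (startRealization act sen W z (0 : s → 𝕜))).2 i) i
    have t3 := (t1.sub t2).comp (tendsto_add_atTop_nat 1)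
    rw [sub_self] at t3
    exact t3.congr fun k => (hdiff k i i).symm
  have hnorm := htrace.norm
  simp only [Finset.sum_const_zero, norm_zero] at hnorm
  refine hnorm.congr fun k => ?_
  have he := energy_eq_sum_trace (w := jointStep act sen)
    (Γ := fun z l z' => Γ (stepMode z l z')) (k + 1) z v
  simp only [Matrix.trace, Matrix.diag_apply] at he
  rw [Finset.sum_comm, ← he, RCLike.norm_ofReal,
    abs_of_nonneg (energy_nonneg (jointStep_nonneg act sen) _ _ _)]

theorem meanSquareStable_iff {act : MarkovChannel N} {sen : MarkovChannel I}
    {W : Measure (ℕ → Fin nw → 𝕜)} (hW : IsWhiteNoise W) {Γ : Mode N I → Matrix s s 𝕜}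
    {S : Mode N I → Matrix s (Fin nw) 𝕜} :
    MeanSquareStable act sen W Γ S ↔ NoiselessStable act sen Γ :=
  ⟨fun h => h.noiselessStable hW, fun h => h.meanSquareStable hW S⟩

end Construction

end NetworkedControl

theorem theorem3 {𝕜 : Type} [RCLike 𝕜] {nx nu ny nw N I : ℕ}
    (p : NetworkedControl.Plant 𝕜 nx nu ny nw)
    (act : NetworkedControl.MarkovChannel N) (sen : NetworkedControl.MarkovChannel I)
    (W : MeasureTheory.Measure (ℕ → Fin nw → 𝕜)) (hW : NetworkedControl.IsWhiteNoise W) :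
    (∃ (F : Fin N → Matrix (Fin nu) (Fin nx) 𝕜) (M : Fin I → Matrix (Fin nx) (Fin ny) 𝕜),
      NetworkedControl.MeanSquareStable act sen W (p.closedLoopΓ F M) (p.closedLoopS M)) ↔
    p.MSDetectable sen ∧ p.MSStabilizable act sen W := by
  simp only [NetworkedControl.Plant.MSDetectable, NetworkedControl.Plant.MSStabilizable,
    NetworkedControl.meanSquareStable_iff hW, NetworkedControl.noiselessStable_closedLoop_iff,
    NetworkedControl.operatorRadius_secondMomentOp_lt_one_iff p act sen]
  constructor
  · rintro ⟨F, M, hF, hM⟩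
    exact ⟨⟨M, hM⟩, F, hF⟩
  · rintro ⟨⟨M, hM⟩, F, hF⟩
    exact ⟨F, M, hF, hM⟩
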